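/- **Setting.** Let $N_{UE}\ge 1$ users and $N_{AP}$ access points be given, access point $j$ having $N_{A_j}$ antennas, with channel vectors $\boldsymbol h_{ij}\in\mathbb C^{N_{A_j}}$, $\boldsymbol H_{ij}=\boldsymbol h_{ij}\boldsymbol h_{ij}^H$, where for each user $i$ at least one $\boldsymbol h_{ij}$ is nonzero. Let $\sigma_i,\eta_i,v_i^{(1)},v_i^{(2)}>0$ and $P_{max}>0$. The DC program $(P)$ is to maximize $\hat\lambda$ over Hermitian matrices $\boldsymbol X_{lj}\in\mathbb C^{N_{A_j}\times N_{A_j}}$ and real $\alpha_i,\beta_i,R_i,E_i,I_i,\hat\lambda$ subject to, for all $i,l,j$, - $(\overline{C1})$ $\log\alpha_i+\log R_i\ge\hat\lambda+\log v_i^{(1)}$; - $(\overline{C2})$ $\log\beta_i+\log(\eta_iE_i)\ge\hat\lambda+\log v_i^{(2)}$; - $(C3)$ $E_i=\sum_j\sum_l\mathrm{trace}(\boldsymbol H_{ij}\boldsymbol X_{lj})$; - $(C4)$ $I_i=\sum_j\sum_{l\ne i}\mathrm{trace}(\boldsymbol H_{ij}\boldsymbol X_{lj})$; - $(\overline{C5})$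 $R_i\le\log(E_i+\sigma_i^2)-\log(I_i+\sigma_i^2)$; - $(C6)$ $\sum_j\sum_l\mathrm{trace}(\boldsymbol X_{lj})\le P_{max}$; - $(C7)$ $\boldsymbol X_{lj}\succeq0$; - $(C8)$ $\alpha_i+\beta_i=1$; - $(C9)$ $\alpha_i\in[0,1]$; where $\alpha_i,\beta_i,R_i,E_i>0$ is implicit in the logarithms. A *stationary point* of $(P)$ is a feasible point at which the Karush–Kuhn–Tucker conditions of $(P)$ hold for some Lagrange multipliers. For $J\in\mathbb R^{N_{UE}}$ let $(P_J)$ be the convex program obtained from $(P)$ by replacing $\log(I_i+\sigma_i^2)$ in $(\overline{C5})$ by $\log(J_i+\sigma_i^2)+\frac{1}{J_i+\sigma_i^2}(I_i-J_i)$. **Algorithm 1 (convex-concave procedure).** Let $D\subset\mathbb R^{N_{UE}}$ be the set of the $I$-components of all points satisfying $(C3),(C4),(C6)$–$(C9)$ and, for some real $\lambda$, the constraints $\alpha_iR_i\ge\lambda v_i^{(1)}$ and $\beta_i\eta_iE_i\ge\lambda v_i^{(2)}$ for all $i$. Fix a step size $\gamma\in(0,1]$ and a tolerance $\epsilon>0$.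 Choose $I^0\in D$. For $k=0,1,2,\dots$ let $x^k$ be any optimal solution of $(P_{I^k})$, and let $\hat I^k$ be its $I$-component and $\hat\lambda^k$ its objective value; stop if $\|\hat I^k-I^k\|_2\le\epsilon$, and otherwise set $I^{k+1}=I^k+\gamma(\hat I^k-I^k)$. **Proposition.** Algorithm 1 converges to stationary points of $(P)$, in the following sense. 1. The algorithm is well defined: $D\neq\emptyset$; for every $I\in D$ the program $(P_I)$ has an optimal solution, and for every optimal solution, with $I$-component $\hat I$, the point $I+\gamma(\hat I-I)$ is again in $D$. Moreover, for all sequences $(I^k)$, $(x^k)$ generated by the algorithm when the stopping test is ignored: 2. $\|\hat I^k-I^k\|_2\to0$, so that the stopping test is met after finitely many steps for every $\epsilon>0$; and whenever $\hat I^k=I^k$, the point $x^k$ is a stationary point of $(P)$. 3. The objective values $\hat\lambda^k$ converge to some $\lambda^*\in\mathbb R$, and every subsequence of $(x^k,I^k)$ has a further subsequence along which $x^k$ converges to a stationary point $x^*$ of $(P)$ with objective value $\lambda^*$, while $I^k$ converges to the $I$-component of $x^*$. In particular limit points exist, and every limit point of $(x^k)$ is a stationary point of $(P)$. 4. The set of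 limit points of $(I^k)$ is nonempty and connected (so $(I^k)$ converges as soon as one of its limit points is isolated in this set). -/

import Mathlib

open Filter Topology

namespace SWIPT

open scoped ComplexOrder

/-- Data of a multi-access-point downlink: `NUE` single-antenna users, `NAP` access points, access
point `j` with `NA j` antennas, channels `h i j`, noise standard deviations `σ i`, harvesting
efficiencies `η i`, preference weights `v1 i`, `v2 i`, and the power budget `Pmax`. -/
structure Network where
  NUE : ℕ
  NAP : ℕ
  NA : Fin NAP → ℕ
  h : Fin NUE → (j : Fin NAP) → Fin (NA j) → ℂ
  σ : Fin NUE → ℝ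
  η : Fin NUE → ℝ
  v1 : Fin NUE → ℝ
  v2 : Fin NUE → ℝ
  Pmax : ℝ

variable (S : Network)

/-- Families of transmit covariance matrices `X l j`. -/
abbrev Precoders : Type :=
  Fin S.NUE → (j : Fin S.NAP) → Matrix (Fin (S.NA j)) (Fin (S.NA j)) ℂ

/-- The channel matrix `h_ij h_ij^H`. -/
noncomputable def chan (i : Fin S.NUE) (j : Fin S.NAP) : Matrix (Fin (S.NA j)) (Fin (S.NA j)) ℂ :=
  Matrix.vecMulVec (S.h i j) (star (S.h i j))

/-- Received energy of user `i`. -/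
noncomputable def energy (X : Precoders S) (i : Fin S.NUE) : ℝ :=
  ∑ j, ∑ l, (Matrix.trace (chan S i j * X l j)).re

/-- Received interference power of user `i`. -/
noncomputable def interference (X : Precoders S) (i : Fin S.NUE) : ℝ :=
  ∑ j, ∑ l ∈ Finset.univ.erase i, (Matrix.trace (chan S i j * X l j)).re

/-- Total transmit power. -/
noncomputable def power (X : Precoders S) : ℝ :=
  ∑ j, ∑ l, (Matrix.trace (X l j)).re

/-- The decision variables. The field `lam` is the objective, the logarithm of the Chebyshev
level. -/
structure Vars where
  X : Precoders S
  α : Fin S.NUE → ℝ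
  β : Fin S.NUE → ℝ
  R : Fin S.NUE → ℝ
  E : Fin S.NUE → ℝ
  I : Fin S.NUE → ℝ
  lam : ℝ

variable {S}

/-- The point `x + t d`. -/
noncomputable def Vars.move (x d : Vars S) (t : ℝ) : Vars S where
  X := fun l j => x.X l j + t • d.X l j
  α := x.α + t • d.α
  β := x.β + t • d.β
  R := x.R + t • d.R
  E := x.E + t • d.E
  I := x.I + t • d.I
  lam := x.lam + t * d.lam

/-- Convergence of a sequence of points, in every variable. -/
structure Vars.ConvergesTo (u : ℕ → Vars S) (x : Vars S) : Prop where
  X : Tendsto (fun k => (u k).X) atTop (𝓝 x.X)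
  α : Tendsto (fun k => (u k).α) atTop (𝓝 x.α)
  β : Tendsto (fun k => (u k).β) atTop (𝓝 x.β)
  R : Tendsto (fun k => (u k).R) atTop (𝓝 x.R)
  E : Tendsto (fun k => (u k).E) atTop (𝓝 x.E)
  I : Tendsto (fun k => (u k).I) atTop (𝓝 x.I)
  lam : Tendsto (fun k => (u k).lam) atTop (𝓝 x.lam)

/-- The constraints on `X`, `α`, `β`, `E`, `I` alone: the definitions of `E` and `I`, the power
budget, positive semidefiniteness, and the time-switching ratios. -/
structure Vars.Linear (x : Vars S) : Prop where
  E_eq : ∀ i, x.E i = energy S x.X i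
  I_eq : ∀ i, x.I i = interference S x.X i
  power_le : power S x.X ≤ S.Pmax
  psd : ∀ l j, (x.X l j).PosSemidef
  add_eq_one : ∀ i, x.α i + x.β i = 1
  ratio_mem : ∀ i, x.α i ∈ Set.Icc (0 : ℝ) 1

/-- All constraints of the DC program except the rate constraint. The four positivity conditions
are the domain of the logarithms in the two utility constraints (a point with a logarithm of `0`,
that is `-∞`, is infeasible). -/
structure Vars.Common (x : Vars S) : Prop extends x.Linear where
  α_pos : ∀ i, 0 < x.α i
  β_pos : ∀ i, 0 < x.β i
  R_pos : ∀ i, 0 < x.R i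
  E_pos : ∀ i, 0 < x.E i
  rate_utility : ∀ i, x.lam + Real.log (S.v1 i) ≤ Real.log (x.α i) + Real.log (x.R i)
  energy_utility : ∀ i, x.lam + Real.log (S.v2 i) ≤ Real.log (x.β i) + Real.log (S.η i * x.E i)

/-- Feasible points of the DC program. -/
structure Vars.Feasible (x : Vars S) : Prop extends x.Common where
  rate : ∀ i, x.R i ≤ Real.log (x.E i + S.σ i ^ 2) - Real.log (x.I i + S.σ i ^ 2)

/-- Feasible points of the convex subproblem, with `log (I_i + σ_i ^ 2)` linearized at `J i`. -/
structure Vars.SubFeasible (J : Fin S.NUE → ℝ) (x : Vars S) : Prop extends x.Common where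
  rate : ∀ i, x.R i ≤ Real.log (x.E i + S.σ i ^ 2) -
    (Real.log (J i + S.σ i ^ 2) + 1 / (J i + S.σ i ^ 2) * (x.I i - J i))

/-- Optimal solutions of the convex subproblem linearized at `J`. -/
def Vars.SubOptimal (J : Fin S.NUE → ℝ) (x : Vars S) : Prop :=
  x.SubFeasible J ∧ ∀ y : Vars S, y.SubFeasible J → y.lam ≤ x.lam

variable (S) in
/-- Lagrange multipliers of the DC program. -/
structure Multipliers where
  rateUtility : Fin S.NUE → ℝ
  energyUtility : Fin S.NUE → ℝ
  energyEq : Fin S.NUE → ℝ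
  interfEq : Fin S.NUE → ℝ
  rate : Fin S.NUE → ℝ
  power : ℝ
  psd : Precoders S
  sumEq : Fin S.NUE → ℝ
  ratioLower : Fin S.NUE → ℝ
  ratioUpper : Fin S.NUE → ℝ

/-- The Lagrangian of the DC program (a maximization problem). -/
noncomputable def lagrangian (m : Multipliers S) (x : Vars S) : ℝ :=
  x.lam
  + ∑ i, m.rateUtility i *
      (Real.log (x.α i) + Real.log (x.R i) - (x.lam + Real.log (S.v1 i)))
  + ∑ i, m.energyUtility i *
      (Real.log (x.β i) + Real.log (S.η i * x.E i) - (x.lam + Real.log (S.v2 i)))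
  + ∑ i, m.energyEq i * (energy S x.X i - x.E i)
  + ∑ i, m.interfEq i * (interference S x.X i - x.I i)
  + ∑ i, m.rate i *
      (Real.log (x.E i + S.σ i ^ 2) - Real.log (x.I i + S.σ i ^ 2) - x.R i)
  + m.power * (S.Pmax - power S x.X)
  + ∑ l, ∑ j, (Matrix.trace (m.psd l j * x.X l j)).re
  + ∑ i, m.sumEq i * (1 - x.α i - x.β i)
  + ∑ i, m.ratioLower i * x.α i
  + ∑ i, m.ratioUpper i * (1 - x.α i)

/-- Karush-Kuhn-Tucker conditions of the DC program at `x` with multipliers `m`: primal and dual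
feasibility, complementary slackness, and vanishing of the derivative of the Lagrangian at `x` in
every direction of the real space of decision variables (whose matrices are Hermitian). -/
structure IsKKTPair (x : Vars S) (m : Multipliers S) : Prop where
  feasible : x.Feasible
  rateUtility_nonneg : ∀ i, 0 ≤ m.rateUtility i
  energyUtility_nonneg : ∀ i, 0 ≤ m.energyUtility i
  rate_nonneg : ∀ i, 0 ≤ m.rate i
  power_nonneg : 0 ≤ m.power
  psd_nonneg : ∀ l j, (m.psd l j).PosSemidef
  ratioLower_nonneg : ∀ i, 0 ≤ m.ratioLower i
  ratioUpper_nonneg : ∀ i, 0 ≤ m.ratioUpper i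
  rateUtility_slack : ∀ i, m.rateUtility i *
    (Real.log (x.α i) + Real.log (x.R i) - (x.lam + Real.log (S.v1 i))) = 0
  energyUtility_slack : ∀ i, m.energyUtility i *
    (Real.log (x.β i) + Real.log (S.η i * x.E i) - (x.lam + Real.log (S.v2 i))) = 0
  rate_slack : ∀ i, m.rate i *
    (Real.log (x.E i + S.σ i ^ 2) - Real.log (x.I i + S.σ i ^ 2) - x.R i) = 0
  power_slack : m.power * (S.Pmax - power S x.X) = 0
  psd_slack : ∀ l j, m.psd l j * x.X l j = 0
  ratioLower_slack : ∀ i, m.ratioLower i * x.α i = 0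
  ratioUpper_slack : ∀ i, m.ratioUpper i * (1 - x.α i) = 0
  stationary : ∀ d : Vars S, (∀ l j, (d.X l j).IsHermitian) →
    HasDerivAt (fun t : ℝ => lagrangian m (x.move d t)) 0 0

/-- Stationary (KKT) points of the DC program. -/
def Vars.IsStationary (x : Vars S) : Prop :=
  ∃ m : Multipliers S, IsKKTPair x m

variable (S) in
/-- Admissible linearization points: the `I`-components of the points which satisfy all constraints
other than the rate constraint, the two utility constraints being taken in the form
`α_i R_i ≥ λ v1_i`, `β_i η_i E_i ≥ λ v2_i`, with `λ` real. -/
def startSet : Set (Fin S.NUE → ℝ) :=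
  {J | ∃ x : Vars S, x.Linear ∧
    (∃ level : ℝ, (∀ i, level * S.v1 i ≤ x.α i * x.R i) ∧
      (∀ i, level * S.v2 i ≤ x.β i * (S.η i * x.E i))) ∧ x.I = J}

/-- The update of the linearization point with step size `γ`. -/
noncomputable def step (γ : ℝ) (J : Fin S.NUE → ℝ) (x : Vars S) : Fin S.NUE → ℝ :=
  J + γ • (x.I - J)

/-- The quantity compared with the tolerance in the stopping test (Euclidean norm). -/
noncomputable def gap (J : Fin S.NUE → ℝ) (x : Vars S) : ℝ :=
  ‖WithLp.toLp 2 (x.I - J)‖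

/-- The iterates of the convex-concave procedure with step size `γ` when the stopping test is
ignored: `J k` is the `k`-th linearization point, and `x k` is any optimal solution of the
subproblem linearized there. -/
structure IsRun (γ : ℝ) (J : ℕ → Fin S.NUE → ℝ) (x : ℕ → Vars S) : Prop where
  start : J 0 ∈ startSet S
  solve : ∀ k, (x k).SubOptimal (J k)
  update : ∀ k, J (k + 1) = step γ (J k) (x k)

end SWIPT

namespace SWIPT

/-! The logarithm lies below its tangents, so points feasible for a subproblem are feasible for the
DC program. Moving the base point of a tangent towards `I` lowers the tangent at `I`. Hence each
iterate stays feasible for the next subproblem (`Vars.SubFeasible.subFeasible_step`), and the levels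
increase to a limit.

By compactness a subsequence of `(J k, x k)` converges to some `(J', x')` with `x'` feasible for the
subproblem at `J'`. Lower semicontinuity of the subproblem value
(`Vars.SubFeasible.eventually_exists`) makes `x'` optimal for the subproblem at the next base point
`step γ J' x'`. If `J' ≠ x'.I`, some tangent has dropped strictly, so `x'` is an optimal solution
with a slack rate constraint. `Vars.SubOptimal.rateSlack_nonpos` excludes this. Thus `J' = x'.I`,
and `x'` is optimal for the linearization at its own interference. There the linearized and the true
constraint agree to first order, so the multipliers of the subproblem are KKT multipliers of the DC
program (`SubKKT.isStationary`).

The multipliers come from a theorem of the alternative for concave functions at the fixed optimal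
level (`Vars.SubOptimal.exists_subKKT`). They exclude slack as follows. A user `i` with a slack rate
has all its multipliers zero. Handing its beam to a user `l` with positive weight would remove
interference at `l` at no cost, so optimality forces that beam to be unheard by all weighted users.
It then only consumes power, so power has price zero. With free power, amplifying all beams is
strictly profitable because of the noise, which contradicts the first-order conditions.

Gaps therefore tend to zero along every subsequence. A sequence in a compact set with vanishing
increments has a connected set of limit points. -/

open scoped ComplexOrder

/-! ### Concave alternatives, one-sided derivatives and tangents of the logarithm -/

/-- Theorem of the alternative for concave functions: if finitely many concave functions are never
simultaneously positive, some nontrivial nonnegative combination of them is nonpositive. -/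
theorem exists_nonneg_combination_nonpos {V ι : Type*} [AddCommGroup V] [Module ℝ V] [Fintype ι]
    {D : Set V} (hne : D.Nonempty) {f : ι → V → ℝ} (hf : ∀ i, ConcaveOn ℝ D (f i))
    (hD : Convex ℝ D) (h : ∀ x ∈ D, ∃ i, f i x ≤ 0) :
    ∃ c : ι → ℝ, (∀ i, 0 ≤ c i) ∧ c ≠ 0 ∧ ∀ x ∈ D, ∑ i, c i * f i x ≤ 0 := by
  classical
  -- `A` is open, convex and closed under lowering coordinates. The last property forces a
  -- functional separating it from `0` to have nonnegative coefficients.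
  set A : Set (ι → ℝ) := {y | ∃ x ∈ D, ∀ i, y i < f i x} with hA
  have hAo : IsOpen A := by
    have : A = ⋃ x ∈ D, Set.pi Set.univ fun i => Set.Iio (f i x) := by
      ext y; simp [hA]
    rw [this]
    exact isOpen_biUnion fun x _ => isOpen_set_pi Set.finite_univ fun i _ => isOpen_Iio
  have hAc : Convex ℝ A := by
    rintro y ⟨x, hx, hy⟩ y' ⟨x', hx', hy'⟩ s t hs ht hst
    refine ⟨s • x + t • x', hD hx hx' hs ht hst, fun i => ?_⟩
    refine lt_of_lt_of_le ?_ ((hf i).2 hx hx' hs ht hst)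
    simp only [Pi.add_apply, Pi.smul_apply, smul_eq_mul]
    rcases hs.eq_or_lt with rfl | hs
    · have : t = 1 := by linarith
      subst this; simpa using hy' i
    · have h1 := mul_lt_mul_of_pos_left (hy i) hs
      have h2 := mul_le_mul_of_nonneg_left (hy' i).le ht
      linarith
  have h0 : (0 : ι → ℝ) ∉ A := by
    rintro ⟨x, hx, hy⟩
    obtain ⟨i, hi⟩ := h x hx
    exact absurd (hy i) (not_lt.2 hi)
  obtain ⟨φ, hφ⟩ := geometric_hahn_banach_open_point hAc hAo h0
  have hφs : ∀ y, φ y = ∑ i, φ (Pi.single i 1) * y i := by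
    intro y
    conv_lhs => rw [← Finset.univ_sum_single y]
    rw [map_sum]
    refine Finset.sum_congr rfl fun i _ => ?_
    have : (Pi.single i (y i) : ι → ℝ) = y i • Pi.single i (1 : ℝ) := by
      rw [← Pi.single_smul]; simp
    rw [this, map_smul, smul_eq_mul, mul_comm]
  have hmem : ∀ x ∈ D, ∀ e : ι → ℝ, (∀ i, 0 < e i) → (fun i => f i x) - e ∈ A :=
    fun x hx e he => ⟨x, hx, fun i => by simpa using he i⟩
  obtain ⟨x₀, hx₀⟩ := hne
  refine ⟨fun i => φ (Pi.single i 1), fun i => ?_, fun hc => ?_, fun x hx => ?_⟩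
  · by_contra hneg
    push Not at hneg
    set a := (fun i => f i x₀) - (1 : ι → ℝ) with ha
    -- With a negative coefficient, lowering coordinate `i` by `T` raises `φ` by exactly `|φ a|`, to
    -- a nonnegative value at a point of `A`.
    set T : ℝ := |φ a| / (-φ (Pi.single i 1)) with hT
    have hT0 : 0 ≤ T := div_nonneg (abs_nonneg _) (by linarith)
    have h1 := hφ ((fun i => f i x₀) - (1 + T • Pi.single i 1)) (hmem x₀ hx₀ _ fun j => by
      have : (0 : ℝ) ≤ (Pi.single i (1 : ℝ) : ι → ℝ) j := by
        by_cases hij : j = i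
        · subst hij; simp
        · simp [hij]
      simp only [Pi.add_apply, Pi.one_apply, Pi.smul_apply, smul_eq_mul]
      positivity)
    rw [← sub_sub, ← ha, map_sub, map_smul, map_zero, smul_eq_mul] at h1
    have h2 : T * φ (Pi.single i 1) = -|φ a| := by
      have : φ (Pi.single i 1) ≠ 0 := hneg.ne
      rw [hT, div_neg, neg_mul, div_mul_cancel₀ _ this]
    have := neg_abs_le (φ a)
    linarith
  · have h1 := hφ _ (hmem x₀ hx₀ 1 fun _ => one_pos)
    rw [hφs, map_zero] at h1
    have : ∀ i, φ (Pi.single i 1) = 0 := fun i => congrFun hc i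
    simp [this] at h1
  · have h1 : ∀ ε : ℝ, 0 < ε → φ (fun i => f i x) - ε * φ 1 < 0 := fun ε hε => by
      have := hφ _ (hmem x hx (ε • 1) fun i => by simpa using hε)
      rwa [map_sub, map_smul, map_zero, smul_eq_mul] at this
    rw [← hφs]
    have h2 : Tendsto (fun ε : ℝ => φ (fun i => f i x) - ε * φ 1) (𝓝[>] 0)
        (𝓝 (φ (fun i => f i x) - 0 * φ 1)) :=
      (Continuous.tendsto (by fun_prop) 0).mono_left nhdsWithin_le_nhds
    rw [zero_mul, sub_zero] at h2
    exact le_of_tendsto h2 (eventually_nhdsWithin_of_forall fun ε hε => (h1 ε hε).le)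

/-- A function which is at most its initial value just to the right of `0` has nonpositive
derivative there. -/
theorem deriv_nonpos_of_eventually_le {φ : ℝ → ℝ} {φ' : ℝ} (h : HasDerivAt φ φ' 0)
    (hle : ∀ᶠ t in 𝓝[>] (0 : ℝ), φ t ≤ φ 0) : φ' ≤ 0 := by
  have h1 := (hasDerivWithinAt_iff_tendsto_slope' (s := Set.Ioi (0 : ℝ)) (by simp)).1
    h.hasDerivWithinAt
  refine le_of_tendsto h1 ?_
  filter_upwards [hle, self_mem_nhdsWithin] with t ht ht0
  rw [slope_def_field]
  exact div_nonpos_of_nonpos_of_nonneg (by linarith) (by simpa using le_of_lt ht0)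

theorem eventually_lt_of_deriv_pos {φ : ℝ → ℝ} {φ' : ℝ} (h : HasDerivAt φ φ' 0)
    (hpos : 0 < φ') : ∀ᶠ t in 𝓝[>] (0 : ℝ), φ 0 < φ t := by
  have h1 := (hasDerivWithinAt_iff_tendsto_slope' (s := Set.Ioi (0 : ℝ)) (by simp)).1
    h.hasDerivWithinAt
  filter_upwards [h1.eventually (lt_mem_nhds hpos), self_mem_nhdsWithin] with t ht ht0
  rw [slope_def_field, sub_zero] at ht
  have := (div_pos_iff_of_pos_right (by simpa using ht0)).1 ht
  linarith

theorem log_le_tangent {a b : ℝ} (ha : 0 < a) (hb : 0 < b) :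
    Real.log a ≤ Real.log b + 1 / b * (a - b) := by
  have h := Real.log_le_sub_one_of_pos (div_pos ha hb)
  rw [Real.log_div ha.ne' hb.ne'] at h
  have : 1 / b * (a - b) = a / b - 1 := by field_simp
  linarith

/-- Moving the base point of a tangent of the logarithm towards `a` strictly lowers its value
at `a`. -/
theorem tangent_lt_tangent {a b γ : ℝ} (ha : 0 < a) (hb : 0 < b) (hab : a ≠ b) (h0 : 0 < γ)
    (h1 : γ ≤ 1) :
    Real.log (b + γ * (a - b)) + 1 / (b + γ * (a - b)) * (a - (b + γ * (a - b))) <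
      Real.log b + 1 / b * (a - b) := by
  set c := b + γ * (a - b) with hc
  have hcp : 0 < c := by
    have : c = (1 - γ) * b + γ * a := by rw [hc]; ring
    have h2 : 0 ≤ (1 - γ) * b := mul_nonneg (by linarith) hb.le
    have h3 := mul_pos h0 ha
    linarith
  have hcb : c / b ≠ 1 := by
    rw [Ne, div_eq_one_iff_eq hb.ne', hc]
    simpa [h0.ne', sub_eq_zero] using hab
  have hlog := Real.log_lt_sub_one_of_pos (div_pos hcp hb) hcb
  rw [Real.log_div hcp.ne' hb.ne'] at hlog
  -- The drop of the tangent is the error of `log (c / b) ≤ c / b - 1`, strict since `c ≠ b`, plus a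
  -- product that is nonnegative because `c` lies between `b` and `a`.
  have key : 1 / b * (a - b) - 1 / c * (a - c) - (c / b - 1) = (a - c) * (c - b) / (b * c) := by
    field_simp; ring
  have : 0 ≤ (a - c) * (c - b) / (b * c) := by
    have : (a - c) * (c - b) = (1 - γ) * γ * (a - b) ^ 2 := by rw [hc]; ring
    rw [this]
    have : 0 ≤ 1 - γ := by linarith
    positivity
  linarith

theorem tangent_le_tangent {a b γ : ℝ} (ha : 0 < a) (hb : 0 < b) (h0 : 0 < γ) (h1 : γ ≤ 1) :
    Real.log (b + γ * (a - b)) + 1 / (b + γ * (a - b)) * (a - (b + γ * (a - b))) ≤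
      Real.log b + 1 / b * (a - b) := by
  by_cases hab : a = b
  · simp [hab]
  · exact (tangent_lt_tangent ha hb hab h0 h1).le

theorem log_concave {a b s t : ℝ} (ha : 0 < a) (hb : 0 < b) (hs : 0 ≤ s) (ht : 0 ≤ t)
    (hst : s + t = 1) : s * Real.log a + t * Real.log b ≤ Real.log (s * a + t * b) := by
  simpa using strictConcaveOn_log_Ioi.concaveOn.2 (Set.mem_Ioi.2 ha) (Set.mem_Ioi.2 hb) hs ht hst

/-! ### Connectedness of limit sets -/

/-- The set of limit points of a sequence in a compact set, whose increments tend to zero, is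
connected. -/
theorem isConnected_setOf_mapClusterPt {M : Type*} [PseudoMetricSpace M] {K : Set M}
    (hK : IsCompact K) {u : ℕ → M} (hu : ∀ k, u k ∈ K)
    (hd : Tendsto (fun k => dist (u (k + 1)) (u k)) atTop (𝓝 0)) :
    IsConnected {x | MapClusterPt x atTop u} := by
  set C := {x | MapClusterPt x atTop u} with hC
  have hCcl : IsClosed C := isClosed_setOfPred_clusterPt
  refine ⟨?_, ?_⟩
  · obtain ⟨x, _, hx⟩ := hK.exists_mapClusterPt (f := atTop) (u := u)
      (by simpa using ⟨0, fun k _ => hu k⟩)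
    exact ⟨x, hx⟩
  · rw [isPreconnected_iff_subset_of_fully_disjoint_closed hCcl]
    intro A B hA hB hAB hdisj
    by_contra! hcon
    obtain ⟨hnA, hnB⟩ := hcon
    obtain ⟨b, hbC, hbA⟩ := Set.not_subset.1 hnA
    obtain ⟨a, haC, haB⟩ := Set.not_subset.1 hnB
    have haA : a ∈ A := (hAB haC).resolve_right haB
    have hbB : b ∈ B := (hAB hbC).resolve_left hbA
    have hAne : A.Nonempty := ⟨a, haA⟩
    have hBne : B.Nonempty := ⟨b, hbB⟩
    -- `f` is negative on `A`, positive on `B`, and changes by at most twice the distance.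
    -- Infinitely many sign changes with vanishing increments produce a limit point where `f = 0`,
    -- which lies in neither set.
    set f : M → ℝ := fun x => Metric.infDist x A - Metric.infDist x B with hf
    have hfc : Continuous f := (Metric.continuous_infDist_pt A).sub (Metric.continuous_infDist_pt B)
    have hfA : ∀ x ∈ A, f x < 0 := fun x hx => by
      have h1 : Metric.infDist x A = 0 := Metric.infDist_zero_of_mem hx
      have h2 : 0 < Metric.infDist x B :=
        (hB.notMem_iff_infDist_pos hBne).1 (Set.disjoint_left.1 hdisj hx)
      simp only [hf]; linarith
    have hfB : ∀ x ∈ B, 0 < f x := fun x hx => by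
      have h1 : Metric.infDist x B = 0 := Metric.infDist_zero_of_mem hx
      have h2 : 0 < Metric.infDist x A :=
        (hA.notMem_iff_infDist_pos hAne).1 (Set.disjoint_right.1 hdisj hx)
      simp only [hf]; linarith
    have hstep : ∀ k, f (u (k + 1)) - f (u k) ≤ 2 * dist (u (k + 1)) (u k) := fun k => by
      have h1 := Metric.infDist_le_infDist_add_dist (s := A) (x := u (k + 1)) (y := u k)
      have h2 := Metric.infDist_le_infDist_add_dist (s := B) (x := u k) (y := u (k + 1))
      rw [dist_comm] at h2
      simp only [hf]; linarith
    have hfreqA : ∃ᶠ k in atTop, f (u k) < 0 :=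
      haC.frequently (hfc.continuousAt.eventually (gt_mem_nhds (hfA a haA)))
    have hfreqB : ∃ᶠ k in atTop, 0 < f (u k) :=
      hbC.frequently (hfc.continuousAt.eventually (lt_mem_nhds (hfB b hbB)))
    have hcross : ∀ N, ∃ k ≥ N, f (u k) ≤ 0 ∧ 0 < f (u (k + 1)) := by
      intro N
      obtain ⟨m, hm, hm0⟩ := frequently_atTop.1 hfreqA N
      obtain ⟨n, hn, hn0⟩ := frequently_atTop.1 hfreqB m
      by_contra! hno
      have : ∀ k, m ≤ k → f (u k) ≤ 0 := fun k hk => by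
        induction k, hk using Nat.le_induction with
        | base => exact hm0.le
        | succ k hk ih => exact hno k (hm.trans hk) ih
      exact absurd (this n hn) (not_le.2 hn0)
    choose κ hκ hκ1 hκ2 using hcross
    have hκt : Tendsto κ atTop atTop := tendsto_atTop_mono hκ tendsto_id
    have hlim : Tendsto (fun N => f (u (κ N))) atTop (𝓝 0) := by
      have h2 : Tendsto (fun N => -(2 * dist (u (κ N + 1)) (u (κ N)))) atTop (𝓝 0) := by
        simpa using ((hd.comp hκt).const_mul 2).neg
      refine tendsto_of_tendsto_of_tendsto_of_le_of_le h2 tendsto_const_nhds (fun N => ?_)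
        fun N => hκ1 N
      have := hstep (κ N)
      have := hκ2 N
      dsimp only; linarith
    obtain ⟨x, _, hx⟩ := hK.exists_mapClusterPt (f := atTop) (u := u ∘ κ)
      (by simpa using ⟨0, fun n _ => hu (κ n)⟩)
    have hxC : x ∈ C := MapClusterPt.of_comp hκt hx
    have hfx : f x = 0 := by
      have h3 : MapClusterPt (f x) atTop (fun N => f (u (κ N))) :=
        hx.continuousAt_comp hfc.continuousAt
      by_contra hne
      obtain ⟨U, V, hU, hV, hxU, h0V, hUV⟩ := t2_separation hne
      obtain ⟨n, hn1, hn2⟩ :=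
        ((h3.frequently (hU.mem_nhds hxU)).and_eventually
          (hlim.eventually (hV.mem_nhds h0V))).exists
      exact Set.disjoint_left.1 hUV hn1 hn2
    rcases hAB hxC with h | h
    · exact absurd hfx (hfA x h).ne
    · exact absurd hfx (hfB x h).ne'

/-! ### Positive semidefinite matrices and the trace pairing -/

section Matrix

open Matrix

variable {n : Type*} [Fintype n]

open scoped MatrixOrder Matrix.Norms.L2Operator in
theorem exists_eq_conjTranspose_mul_self {A : Matrix n n ℂ} (hA : A.PosSemidef) :
    ∃ C : Matrix n n ℂ, A = Cᴴ * C := by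
  classical
  exact CStarAlgebra.nonneg_iff_eq_star_mul_self.mp hA.nonneg

theorem trace_mul_nonneg {A B : Matrix n n ℂ} (hA : A.PosSemidef) (hB : B.PosSemidef) :
    0 ≤ (A * B).trace := by
  classical
  obtain ⟨C, rfl⟩ := exists_eq_conjTranspose_mul_self hA
  rw [mul_assoc, trace_mul_comm]
  exact (hB.mul_mul_conjTranspose_same C).trace_nonneg

/-- For `A = Cᴴ * C` and `B = Dᴴ * D` the trace is the squared Frobenius norm of `D * Cᴴ`. This
upgrades scalar complementary slackness to the matrix form. -/
theorem mul_eq_zero_of_trace_mul_eq_zero {A B : Matrix n n ℂ} (hA : A.PosSemidef)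
    (hB : B.PosSemidef) (h : (A * B).trace = 0) : A * B = 0 := by
  classical
  obtain ⟨C, rfl⟩ := exists_eq_conjTranspose_mul_self hA
  obtain ⟨D, rfl⟩ := exists_eq_conjTranspose_mul_self hB
  have h1 : ((D * Cᴴ)ᴴ * (D * Cᴴ)).trace = 0 := by
    rw [← h]
    simp only [conjTranspose_mul, conjTranspose_conjTranspose]
    rw [mul_assoc Cᴴ, trace_mul_comm Cᴴ]
    simp only [mul_assoc]
  have h2 : D * Cᴴ = 0 := trace_conjTranspose_mul_self_eq_zero_iff.1 h1
  have h3 : C * Dᴴ = 0 := by simpa using congrArg conjTranspose h2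
  rw [mul_assoc, ← mul_assoc C, h3]
  simp

/-- Entries of a Gram matrix are inner products of columns, hence at most the mean of two diagonal
entries. This turns the power budget into a bound on the precoders. -/
theorem norm_apply_le_trace {A : Matrix n n ℂ} (hA : A.PosSemidef) (a b : n) :
    ‖A a b‖ ≤ A.trace.re := by
  classical
  obtain ⟨C, rfl⟩ := exists_eq_conjTranspose_mul_self hA
  have hdiag : ∀ c, ((Cᴴ * C) c c).re = ∑ k, ‖C k c‖ ^ 2 := fun c => by
    rw [mul_apply, Complex.re_sum]
    refine Finset.sum_congr rfl fun k _ => ?_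
    rw [conjTranspose_apply, Complex.star_def, Complex.conj_mul']
    norm_cast
  have htr : ∀ c, ((Cᴴ * C) c c).re ≤ (Cᴴ * C).trace.re := fun c => by
    rw [trace, Complex.re_sum]
    exact Finset.single_le_sum (f := fun c => ((Cᴴ * C) c c).re)
      (fun c _ => by rw [hdiag]; positivity) (Finset.mem_univ c)
  have h1 : ‖(Cᴴ * C) a b‖ ≤ ∑ k, ‖C k a‖ * ‖C k b‖ := by
    rw [mul_apply]
    refine (norm_sum_le _ _).trans (Finset.sum_le_sum fun k _ => ?_)
    simp
  have h2 : ∑ k, ‖C k a‖ * ‖C k b‖ ≤ ∑ k, (‖C k a‖ ^ 2 / 2 + ‖C k b‖ ^ 2 / 2) :=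
    Finset.sum_le_sum fun k _ => by nlinarith [sq_nonneg (‖C k a‖ - ‖C k b‖)]
  rw [Finset.sum_add_distrib, ← Finset.sum_div, ← Finset.sum_div, ← hdiag, ← hdiag] at h2
  linarith [htr a, htr b]

theorem isClosed_setOf_posSemidef : IsClosed {A : Matrix n n ℂ | A.PosSemidef} := by
  have : {A : Matrix n n ℂ | A.PosSemidef} =
      {A | Aᴴ = A} ∩ ⋂ x : n → ℂ, {A | 0 ≤ star x ⬝ᵥ (A *ᵥ x)} := by
    ext A; simp [posSemidef_iff_dotProduct_mulVec, IsHermitian]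
  rw [this]
  refine (isClosed_eq (by fun_prop) (by fun_prop)).inter
    (isClosed_iInter fun x => isClosed_le (by fun_prop) (by fun_prop))

/-- A Hermitian matrix whose trace against every positive semidefinite matrix is nonnegative is
positive semidefinite. -/
theorem posSemidef_of_trace_mul_nonneg {A : Matrix n n ℂ} (hA : A.IsHermitian)
    (h : ∀ B : Matrix n n ℂ, B.PosSemidef → 0 ≤ (A * B).trace.re) : A.PosSemidef := by
  classical
  refine posSemidef_iff_dotProduct_mulVec.2 ⟨hA, fun x => ?_⟩
  have h1 : (A * vecMulVec x (star x)).trace = star x ⬝ᵥ (A *ᵥ x) := by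
    rw [mul_vecMulVec, trace_vecMulVec, dotProduct_comm]
  rw [Complex.nonneg_iff]
  refine ⟨h1 ▸ h _ (posSemidef_vecMulVec_self_star x), ?_⟩
  have := hA.im_star_dotProduct_mulVec_self x
  simpa using this.symm

end Matrix

/-! ### Linear functionals of the precoders, the budget set and the start set -/

variable {S : Network}

/-- Power received by user `i` from the beams `A` of one user. -/
noncomputable def received (i : Fin S.NUE) (A : ∀ j, Matrix (Fin (S.NA j)) (Fin (S.NA j)) ℂ) : ℝ :=
  ∑ j, (Matrix.trace (chan S i j * A j)).re

theorem energy_eq_sum (X : Precoders S) (i : Fin S.NUE) :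
    energy S X i = ∑ l, received i (X l) := Finset.sum_comm

theorem interference_eq_sum (X : Precoders S) (i : Fin S.NUE) :
    interference S X i = ∑ l ∈ Finset.univ.erase i, received i (X l) := Finset.sum_comm

theorem energy_eq_interference_add (X : Precoders S) (i : Fin S.NUE) :
    energy S X i = interference S X i + received i (X i) := by
  rw [energy_eq_sum, interference_eq_sum, Finset.sum_erase_add _ _ (Finset.mem_univ i)]

theorem received_add (i : Fin S.NUE) (A B : ∀ j, Matrix (Fin (S.NA j)) (Fin (S.NA j)) ℂ) :
    received i (A + B) = received i A + received i B := by
  simp [received, mul_add, Finset.sum_add_distrib]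

theorem received_smul (i : Fin S.NUE) (t : ℝ)
    (A : ∀ j, Matrix (Fin (S.NA j)) (Fin (S.NA j)) ℂ) :
    received i (t • A) = t * received i A := by
  simp [received, Finset.mul_sum]

theorem received_zero (i : Fin S.NUE) : received (S := S) i 0 = 0 := by
  simp [received]

theorem energy_add (X Y : Precoders S) (i : Fin S.NUE) :
    energy S (X + Y) i = energy S X i + energy S Y i := by
  simp [energy_eq_sum, received_add, Finset.sum_add_distrib]

theorem energy_smul (t : ℝ) (X : Precoders S) (i : Fin S.NUE) :
    energy S (t • X) i = t * energy S X i := by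
  simp [energy_eq_sum, received_smul, Finset.mul_sum]

theorem interference_add (X Y : Precoders S) (i : Fin S.NUE) :
    interference S (X + Y) i = interference S X i + interference S Y i := by
  simp [interference_eq_sum, received_add, Finset.sum_add_distrib]

theorem interference_smul (t : ℝ) (X : Precoders S) (i : Fin S.NUE) :
    interference S (t • X) i = t * interference S X i := by
  rw [interference_eq_sum, interference_eq_sum, Finset.mul_sum]
  exact Finset.sum_congr rfl fun l _ => received_smul i t (X l)

theorem power_add (X Y : Precoders S) : power S (X + Y) = power S X + power S Y := by
  simp [power, Finset.sum_add_distrib]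

theorem power_smul (t : ℝ) (X : Precoders S) : power S (t • X) = t * power S X := by
  simp [power, Finset.mul_sum]

theorem continuous_energy (i : Fin S.NUE) : Continuous fun X : Precoders S => energy S X i := by
  unfold energy; fun_prop

theorem continuous_interference (i : Fin S.NUE) :
    Continuous fun X : Precoders S => interference S X i := by
  unfold interference; fun_prop

theorem continuous_power : Continuous fun X : Precoders S => power S X := by
  unfold power; fun_prop

theorem chan_posSemidef (i : Fin S.NUE) (j : Fin S.NAP) : (chan S i j).PosSemidef :=
  Matrix.posSemidef_vecMulVec_self_star _

theorem received_nonneg (i : Fin S.NUE) {A : ∀ j, Matrix (Fin (S.NA j)) (Fin (S.NA j)) ℂ}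
    (hA : ∀ j, (A j).PosSemidef) : 0 ≤ received i A :=
  Finset.sum_nonneg fun j _ =>
    (Complex.nonneg_iff.1 (trace_mul_nonneg (chan_posSemidef i j) (hA j))).1

theorem trace_re_nonneg {n : Type*} [Fintype n] {A : Matrix n n ℂ} (hA : A.PosSemidef) :
    0 ≤ A.trace.re := (Complex.nonneg_iff.1 hA.trace_nonneg).1

variable (S) in
/-- The cone of families of positive semidefinite matrices. -/
def psdCone : Set (Precoders S) := {X | ∀ l j, (X l j).PosSemidef}

theorem add_mem_psdCone {X Y : Precoders S} (hX : X ∈ psdCone S) (hY : Y ∈ psdCone S) :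
    X + Y ∈ psdCone S := fun l j => (hX l j).add (hY l j)

theorem smul_mem_psdCone {t : ℝ} (ht : 0 ≤ t) {X : Precoders S} (hX : X ∈ psdCone S) :
    t • X ∈ psdCone S := fun l j => (hX l j).smul ht

theorem zero_mem_psdCone : (0 : Precoders S) ∈ psdCone S := fun _ _ => Matrix.PosSemidef.zero

theorem single_mem_psdCone (l : Fin S.NUE)
    {A : ∀ j, Matrix (Fin (S.NA j)) (Fin (S.NA j)) ℂ} (hA : ∀ j, (A j).PosSemidef) :
    (Pi.single l A : Precoders S) ∈ psdCone S := by
  intro m j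
  by_cases h : m = l
  · subst h; simpa using hA j
  · simpa [Pi.single_eq_of_ne h] using Matrix.PosSemidef.zero

theorem interference_nonneg {X : Precoders S} (hX : X ∈ psdCone S) (i : Fin S.NUE) :
    0 ≤ interference S X i := by
  rw [interference_eq_sum]
  exact Finset.sum_nonneg fun l _ => received_nonneg i (hX l)

theorem energy_nonneg {X : Precoders S} (hX : X ∈ psdCone S) (i : Fin S.NUE) :
    0 ≤ energy S X i := by
  rw [energy_eq_sum]
  exact Finset.sum_nonneg fun l _ => received_nonneg i (hX l)

theorem power_nonneg {X : Precoders S} (hX : X ∈ psdCone S) : 0 ≤ power S X :=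
  Finset.sum_nonneg fun j _ => Finset.sum_nonneg fun l _ => trace_re_nonneg (hX l j)

theorem trace_re_le_power {X : Precoders S} (hX : X ∈ psdCone S) (l : Fin S.NUE)
    (j : Fin S.NAP) : (X l j).trace.re ≤ power S X :=
  (Finset.single_le_sum (f := fun l => (X l j).trace.re)
    (fun l _ => trace_re_nonneg (hX l j)) (Finset.mem_univ l)).trans
  (Finset.single_le_sum (f := fun j => ∑ l, (X l j).trace.re)
    (fun j _ => Finset.sum_nonneg fun l _ => trace_re_nonneg (hX l j)) (Finset.mem_univ j))

theorem received_eq_zero_of_power_eq_zero {X : Precoders S} (hX : X ∈ psdCone S)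
    (h : power S X = 0) (i l : Fin S.NUE) : received i (X l) = 0 := by
  have : X l = 0 := by
    funext j
    refine (hX l j).trace_eq_zero_iff.1 (Complex.ext ?_ ?_)
    · exact le_antisymm ((trace_re_le_power hX l j).trans h.le) (trace_re_nonneg (hX l j))
    · exact (Complex.nonneg_iff.1 (hX l j).trace_nonneg).2.symm
  rw [this, received_zero]

theorem interference_single (i l : Fin S.NUE)
    (A : ∀ j, Matrix (Fin (S.NA j)) (Fin (S.NA j)) ℂ) :
    interference S (Pi.single l A) i = if i = l then 0 else received i A := by
  rw [interference_eq_sum]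
  split_ifs with h
  · subst h
    refine Finset.sum_eq_zero fun m hm => ?_
    rw [Pi.single_eq_of_ne (Finset.ne_of_mem_erase hm), received_zero]
  · rw [Finset.sum_eq_single l (fun m _ hm => by rw [Pi.single_eq_of_ne hm, received_zero])
      (fun hl => absurd (Finset.mem_erase.2 ⟨Ne.symm h, Finset.mem_univ l⟩) hl), Pi.single_eq_same]

theorem energy_single (i l : Fin S.NUE)
    (A : ∀ j, Matrix (Fin (S.NA j)) (Fin (S.NA j)) ℂ) :
    energy S (Pi.single l A) i = received i A := by
  rw [energy_eq_interference_add, interference_single]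
  split_ifs with h
  · subst h; simp
  · rw [Pi.single_eq_of_ne h, received_zero, add_zero]

theorem power_single (l : Fin S.NUE)
    (A : ∀ j, Matrix (Fin (S.NA j)) (Fin (S.NA j)) ℂ) :
    power S (Pi.single l A) = ∑ j, (A j).trace.re := by
  refine Finset.sum_congr rfl fun j _ => ?_
  rw [Finset.sum_eq_single l (fun m _ hm => by rw [Pi.single_eq_of_ne hm]; simp) (by simp),
    Pi.single_eq_same]

variable (S) in
/-- The precoders allowed by the power budget. -/
def budgetSet : Set (Precoders S) := {X | X ∈ psdCone S ∧ power S X ≤ S.Pmax}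

theorem isClosed_budgetSet : IsClosed (budgetSet S) := by
  have : budgetSet S = (⋂ l, ⋂ j, {X | (X l j).PosSemidef}) ∩ {X | power S X ≤ S.Pmax} := by
    ext X; simp [budgetSet, psdCone]
  rw [this]
  refine (isClosed_iInter fun l => isClosed_iInter fun j => ?_).inter
    (isClosed_le continuous_power continuous_const)
  exact isClosed_setOf_posSemidef.preimage
    (f := fun X : Precoders S => X l j) (by fun_prop)

theorem isCompact_budgetSet : IsCompact (budgetSet S) := by
  have h1 : ∀ j : Fin S.NAP, IsCompact (Set.pi Set.univ fun a => Set.pi Set.univ fun b =>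
      Metric.closedBall 0 S.Pmax : Set (Matrix (Fin (S.NA j)) (Fin (S.NA j)) ℂ)) := fun j =>
    isCompact_univ_pi fun _ => isCompact_univ_pi fun _ => isCompact_closedBall (0 : ℂ) S.Pmax
  have hK : IsCompact (Set.pi Set.univ fun l => Set.pi Set.univ fun j => Set.pi Set.univ fun a =>
      Set.pi Set.univ fun b => Metric.closedBall 0 S.Pmax : Set (Precoders S)) :=
    isCompact_univ_pi fun _ => isCompact_univ_pi h1
  refine hK.of_isClosed_subset isClosed_budgetSet fun X hX l _ j _ a _ b _ => ?_
  rw [mem_closedBall_zero_iff]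
  exact (norm_apply_le_trace (hX.1 l j) a b).trans ((trace_re_le_power hX.1 l j).trans hX.2)

theorem combination_mem_budgetSet {X Y : Precoders S} (hX : X ∈ budgetSet S) (hY : Y ∈ budgetSet S)
    {s t : ℝ} (hs : 0 ≤ s) (ht : 0 ≤ t) (hst : s + t = 1) : s • X + t • Y ∈ budgetSet S := by
  refine ⟨add_mem_psdCone (smul_mem_psdCone hs hX.1) (smul_mem_psdCone ht hY.1), ?_⟩
  rw [power_add, power_smul, power_smul]
  have h1 := mul_le_mul_of_nonneg_left hX.2 hs
  have h2 := mul_le_mul_of_nonneg_left hY.2 ht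
  have : S.Pmax = s * S.Pmax + t * S.Pmax := by rw [← add_mul, hst, one_mul]
  linarith

theorem zero_mem_budgetSet (hP : 0 < S.Pmax) : (0 : Precoders S) ∈ budgetSet S :=
  ⟨zero_mem_psdCone, by simpa [power] using hP.le⟩

theorem Vars.Linear.mem_budgetSet {x : Vars S} (h : x.Linear) : x.X ∈ budgetSet S :=
  ⟨h.psd, h.power_le⟩

/-- The admissible linearization points are the interference vectors of the allowed precoders. -/
theorem startSet_eq_image (hη : ∀ i, 0 < S.η i) :
    startSet S = (interference S) '' budgetSet S := by
  ext J
  constructor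
  · rintro ⟨x, hx, -, rfl⟩
    exact ⟨x.X, hx.mem_budgetSet, (funext hx.I_eq).symm⟩
  · rintro ⟨X, hX, rfl⟩
    -- Level `0` and `R = 0` satisfy the product form of the utility constraints, so only the budget
    -- restricts `X`.
    refine ⟨⟨X, fun _ => 1 / 2, fun _ => 1 / 2, 0, energy S X, interference S X, 0⟩,
      ⟨fun _ => rfl, fun _ => rfl, hX.2, hX.1, fun _ => by norm_num, fun _ => by
        constructor <;> norm_num⟩, ⟨0, fun i => by simp, fun i => ?_⟩, rfl⟩
    have := mul_nonneg (hη i).le (energy_nonneg hX.1 i)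
    simp only [zero_mul]
    positivity

theorem nonneg_of_mem_startSet {J : Fin S.NUE → ℝ} (hJ : J ∈ startSet S) (i : Fin S.NUE) :
    0 ≤ J i := by
  obtain ⟨x, hx, -, rfl⟩ := hJ
  rw [hx.I_eq]
  exact interference_nonneg hx.psd i

theorem isCompact_startSet (hη : ∀ i, 0 < S.η i) : IsCompact (startSet S) := by
  rw [startSet_eq_image hη]
  exact isCompact_budgetSet.image (continuous_pi fun i => continuous_interference i)

/-- Interference is linear and the budget set convex, so the damped update is the interference of a
convex combination of precoders. -/
theorem step_mem_startSet (hη : ∀ i, 0 < S.η i) {γ : ℝ} (h0 : 0 < γ) (h1 : γ ≤ 1)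
    {J : Fin S.NUE → ℝ} (hJ : J ∈ startSet S) {x : Vars S} (hx : x.Linear) :
    step γ J x ∈ startSet S := by
  rw [startSet_eq_image hη] at hJ ⊢
  obtain ⟨X, hX, rfl⟩ := hJ
  refine ⟨(1 - γ) • X + γ • x.X,
    combination_mem_budgetSet hX hx.mem_budgetSet (by linarith) h0.le (by ring), ?_⟩
  funext i
  simp only [step, interference_add, interference_smul, Pi.add_apply, Pi.smul_apply, Pi.sub_apply,
    smul_eq_mul, hx.I_eq]
  ring

/-- Isotropic beams reach every user with a nonzero channel, since the trace of a channel matrix is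
the squared norm of the channel vector. The added `1` keeps the scaling denominator positive. -/
theorem exists_positive_signal (hh : ∀ i, ∃ j, S.h i j ≠ 0) (hP : 0 < S.Pmax) :
    ∃ Y ∈ budgetSet S, ∀ i, 0 < received i (Y i) := by
  set U : Precoders S := fun _ _ => 1 with hU
  have hUp : U ∈ psdCone S := fun _ _ => Matrix.PosSemidef.one
  have hp := power_nonneg hUp
  have hs : 0 < S.Pmax / (power S U + 1) := by positivity
  refine ⟨(S.Pmax / (power S U + 1)) • U, ⟨smul_mem_psdCone hs.le hUp, ?_⟩, fun i => ?_⟩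
  · rw [power_smul, div_mul_eq_mul_div, div_le_iff₀ (by positivity)]
    nlinarith
  · rw [Pi.smul_apply, received_smul]
    refine mul_pos hs ?_
    have h1 : ∀ j, (Matrix.trace (chan S i j * U i j)).re = ∑ a, ‖S.h i j a‖ ^ 2 := fun j => by
      rw [hU, mul_one, chan, Matrix.trace_vecMulVec, dotProduct, Complex.re_sum]
      refine Finset.sum_congr rfl fun a _ => ?_
      rw [Pi.star_apply, Complex.star_def, Complex.mul_conj']
      norm_cast
    obtain ⟨j, hj⟩ := hh i
    obtain ⟨a, ha⟩ := Function.ne_iff.1 hj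
    refine Finset.sum_pos' (fun j _ => by rw [h1]; positivity) ⟨j, Finset.mem_univ j, ?_⟩
    rw [h1]
    exact Finset.sum_pos' (fun a _ => by positivity)
      ⟨a, Finset.mem_univ a, by have : S.h i j a ≠ 0 := ha
                                positivity⟩

/-! ### Feasibility, compactness and solvability of the subproblem -/

variable (S) in
/-- The standing assumptions on the network. -/
structure Network.Admissible : Prop where
  users : 0 < S.NUE
  channel : ∀ i, ∃ j, S.h i j ≠ 0
  σ_pos : ∀ i, 0 < S.σ i
  η_pos : ∀ i, 0 < S.η i
  v1_pos : ∀ i, 0 < S.v1 i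
  v2_pos : ∀ i, 0 < S.v2 i
  Pmax_pos : 0 < S.Pmax

theorem Network.Admissible.add_sq_pos (hS : S.Admissible) {a : ℝ} (ha : 0 ≤ a) (i : Fin S.NUE) :
    0 < a + S.σ i ^ 2 := by
  have := hS.σ_pos i
  positivity

theorem Vars.Linear.I_nonneg {x : Vars S} (h : x.Linear) (i : Fin S.NUE) : 0 ≤ x.I i := by
  rw [h.I_eq]; exact interference_nonneg h.psd i

theorem Vars.Linear.E_nonneg {x : Vars S} (h : x.Linear) (i : Fin S.NUE) : 0 ≤ x.E i := by
  rw [h.E_eq]; exact energy_nonneg h.psd i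

/-- The linearized rate constraint is stronger than the rate constraint. -/
theorem Vars.SubFeasible.feasible (hS : S.Admissible) {J : Fin S.NUE → ℝ} (hJ : ∀ i, 0 ≤ J i)
    {x : Vars S} (h : x.SubFeasible J) : x.Feasible := by
  refine ⟨h.toCommon, fun i => (h.rate i).trans ?_⟩
  have := log_le_tangent (hS.add_sq_pos (h.I_nonneg i) i) (hS.add_sq_pos (hJ i) i)
  rw [add_sub_add_right_eq_sub] at this
  linarith

theorem Vars.Feasible.I_lt_E (hS : S.Admissible) {x : Vars S} (h : x.Feasible) (i : Fin S.NUE) :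
    x.I i < x.E i := by
  have h1 := h.rate i
  have h2 := h.R_pos i
  have h3 : Real.log (x.I i + S.σ i ^ 2) < Real.log (x.E i + S.σ i ^ 2) := by linarith
  have := (Real.log_lt_log_iff (hS.add_sq_pos (h.I_nonneg i) i)
    (hS.add_sq_pos (h.E_nonneg i) i)).1 h3
  linarith

/-- This is the tangent of the logarithm at `σ i ^ 2`, combined with nonnegative interference. It
bounds the rates, and through them the level, on the budget set. -/
theorem Vars.Feasible.R_le (hS : S.Admissible) {x : Vars S} (h : x.Feasible) (i : Fin S.NUE) :
    x.R i ≤ x.E i / S.σ i ^ 2 := by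
  have hs : 0 < S.σ i ^ 2 := by have := hS.σ_pos i; positivity
  have h1 := log_le_tangent (hS.add_sq_pos (h.E_nonneg i) i) hs
  have h2 : Real.log (S.σ i ^ 2) ≤ Real.log (x.I i + S.σ i ^ 2) :=
    Real.log_le_log hs (by linarith [h.I_nonneg i])
  have h3 := h.rate i
  have : 1 / S.σ i ^ 2 * (x.E i + S.σ i ^ 2 - S.σ i ^ 2) = x.E i / S.σ i ^ 2 := by ring
  linarith

theorem exists_bound (hS : S.Admissible) :
    ∃ (M : Fin S.NUE → ℝ) (L : ℝ), ∀ x : Vars S, x.Feasible → x.R ≤ M ∧ x.lam ≤ L := by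
  have hB : ∀ i, ∃ B, ∀ X ∈ budgetSet S, energy S X i ≤ B := fun i => by
    obtain ⟨B, hB⟩ :=
      (isCompact_budgetSet (S := S)).bddAbove_image (continuous_energy i).continuousOn
    exact ⟨B, fun X hX => hB ⟨X, hX, rfl⟩⟩
  choose B hB using hB
  set i₀ : Fin S.NUE := ⟨0, hS.users⟩
  have hR : ∀ x : Vars S, x.Feasible → ∀ i, x.R i ≤ B i / S.σ i ^ 2 := fun x hx i => by
    refine (hx.R_le hS i).trans ?_
    have := hB i x.X hx.mem_budgetSet
    rw [hx.E_eq]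
    gcongr
  refine ⟨fun i => B i / S.σ i ^ 2, Real.log (B i₀ / S.σ i₀ ^ 2) - Real.log (S.v1 i₀),
    fun x hx => ⟨hR x hx, ?_⟩⟩
  have h1 := hx.rate_utility i₀
  have h2 : Real.log (x.α i₀) ≤ 0 := Real.log_nonpos (hx.α_pos i₀).le (hx.ratio_mem i₀).2
  have h3 := Real.log_le_log (hx.R_pos i₀) (hR x hx i₀)
  linarith

theorem exists_forall_le {n : ℕ} (a : Fin n → ℝ) : ∃ c, ∀ i, c ≤ a i := by
  obtain ⟨c, hc⟩ := (Set.finite_range a).bddBelow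
  exact ⟨c, fun i => hc ⟨i, rfl⟩⟩

/-- The precoders `X` realizing `J` are moved slightly towards some `Y` that gives every user a
signal. A user served by `X` already has a positive linearized rate at `t = 0`. For any other user
that rate vanishes at `t = 0` but has derivative `received i (Y i) / (J i + σ i ^ 2) > 0`. One small
`t` serves all users. -/
theorem exists_subFeasible (hS : S.Admissible) {J : Fin S.NUE → ℝ} (hJ : J ∈ startSet S) :
    ∃ x : Vars S, x.SubFeasible J := by
  have hJ0 := nonneg_of_mem_startSet hJ
  rw [startSet_eq_image hS.η_pos] at hJ
  obtain ⟨X, hX, rfl⟩ := hJ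
  set J := interference S X
  obtain ⟨Y, hY, hYs⟩ := exists_positive_signal hS.channel hS.Pmax_pos
  set Z : ℝ → Precoders S := fun t => (1 - t) • X + t • Y with hZ
  have hEZ : ∀ t i, energy S (Z t) i = energy S X i + t * (energy S Y i - energy S X i) :=
    fun t i => by rw [hZ, energy_add, energy_smul, energy_smul]; ring
  have hIZ : ∀ t i, interference S (Z t) i = J i + t * (interference S Y i - J i) :=
    fun t i => by rw [hZ, interference_add, interference_smul, interference_smul]; ring
  set g : Fin S.NUE → ℝ → ℝ := fun i t => Real.log (energy S (Z t) i + S.σ i ^ 2) -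
    (Real.log (J i + S.σ i ^ 2) + 1 / (J i + S.σ i ^ 2) * (interference S (Z t) i - J i)) with hg
  have hgpos : ∀ i, ∀ᶠ t in 𝓝[>] (0 : ℝ), 0 < g i t := fun i => by
    have hE0 := hS.add_sq_pos (energy_nonneg hX.1 i) i
    have hJs := hS.add_sq_pos (hJ0 i) i
    have hd : HasDerivAt (g i) ((energy S Y i - energy S X i) / (energy S X i + S.σ i ^ 2) -
        1 / (J i + S.σ i ^ 2) * (interference S Y i - J i)) 0 := by
      have h1 : HasDerivAt (fun t : ℝ => energy S (Z t) i + S.σ i ^ 2)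
          (energy S Y i - energy S X i) 0 := by
        simp only [hEZ]
        simpa using (((hasDerivAt_id (0 : ℝ)).mul_const
          (energy S Y i - energy S X i)).const_add (energy S X i)).add_const (S.σ i ^ 2)
      have h2 : HasDerivAt (fun t : ℝ => interference S (Z t) i - J i)
          (interference S Y i - J i) 0 := by
        simp only [hIZ]
        simpa using (((hasDerivAt_id (0 : ℝ)).mul_const
          (interference S Y i - J i)).const_add (J i)).sub_const (J i)
      have hZ0 : energy S (Z 0) i + S.σ i ^ 2 = energy S X i + S.σ i ^ 2 := by rw [hEZ]; ring
      have h3 := (h1.log (by rw [hZ0]; exact hE0.ne')).sub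
        ((h2.const_mul (1 / (J i + S.σ i ^ 2))).const_add (Real.log (J i + S.σ i ^ 2)))
      rwa [hZ0] at h3
    have hg0 : g i 0 = Real.log (energy S X i + S.σ i ^ 2) - Real.log (J i + S.σ i ^ 2) := by
      simp only [hg, hEZ, hIZ]; ring_nf
    have hsum := energy_eq_interference_add X i
    rcases (received_nonneg i (hX.1 i)).eq_or_lt with h0 | hpos
    · have hEJ : energy S X i = J i := by rw [hsum, ← h0, add_zero]
      have hval : (energy S Y i - energy S X i) / (energy S X i + S.σ i ^ 2) -
          1 / (J i + S.σ i ^ 2) * (interference S Y i - J i) =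
          received i (Y i) / (J i + S.σ i ^ 2) := by
        rw [hEJ, energy_eq_interference_add Y i]; ring
      rw [hval] at hd
      have := eventually_lt_of_deriv_pos hd (div_pos (hYs i) hJs)
      rwa [hg0, hEJ, sub_self] at this
    · have : 0 < g i 0 := by
        rw [hg0, sub_pos]
        exact Real.log_lt_log hJs (by rw [hsum]; linarith)
      exact (hd.continuousAt.eventually (lt_mem_nhds this)).filter_mono nhdsWithin_le_nhds
  have hlt1 : ∀ᶠ t in 𝓝[>] (0 : ℝ), t < 1 :=
    (gt_mem_nhds one_pos).filter_mono nhdsWithin_le_nhds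
  obtain ⟨t, ht, ht1, ht0⟩ := ((eventually_all.2 hgpos).and
    (hlt1.and self_mem_nhdsWithin)).exists
  replace ht0 : 0 < t := ht0
  have hZb : Z t ∈ budgetSet S :=
    combination_mem_budgetSet hX hY (by linarith) ht0.le (by ring)
  have hEp : ∀ i, 0 < energy S (Z t) i := fun i => by
    rw [hZ, energy_add, energy_smul, energy_smul, energy_eq_interference_add Y]
    have h1 := mul_nonneg (show (0 : ℝ) ≤ 1 - t by linarith) (energy_nonneg hX.1 i)
    have h2 := mul_pos ht0 (hYs i)
    have h3 := mul_nonneg ht0.le (interference_nonneg hY.1 i)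
    rw [mul_add]; linarith
  obtain ⟨c₁, hc₁⟩ := exists_forall_le fun i =>
    Real.log (1 / 2) + Real.log (g i t) - Real.log (S.v1 i)
  obtain ⟨c₂, hc₂⟩ := exists_forall_le fun i =>
    Real.log (1 / 2) + Real.log (S.η i * energy S (Z t) i) - Real.log (S.v2 i)
  refine ⟨⟨Z t, fun _ => 1 / 2, fun _ => 1 / 2, fun i => g i t, energy S (Z t),
    interference S (Z t), min c₁ c₂⟩, ⟨⟨⟨fun _ => rfl, fun _ => rfl, hZb.2, hZb.1,
    fun _ => by norm_num, fun _ => by constructor <;> norm_num⟩, fun _ => by norm_num,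
    fun _ => by norm_num, ht, hEp, fun i => ?_, fun i => ?_⟩, fun i => le_rfl⟩⟩
  · have := hc₁ i
    have := min_le_left c₁ c₂
    dsimp only at *; linarith
  · have := hc₂ i
    have := min_le_right c₁ c₂
    dsimp only at *; linarith

theorem exp_mul_le_of_utility {lam v a b : ℝ} (hv : 0 < v) (ha : 0 < a) (hb : 0 < b)
    (h : lam + Real.log v ≤ Real.log a + Real.log b) : Real.exp lam * v ≤ a * b := by
  rw [← Real.log_mul ha.ne' hb.ne', ← Real.log_exp lam,
    ← Real.log_mul (Real.exp_pos _).ne' hv.ne'] at h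
  exact (Real.log_le_log_iff (by positivity) (by positivity)).1 h

/-- The product form `exp u * v ≤ a * b` passes to the limit and keeps both limit factors away from
`0`, so the logarithms are continuous there. -/
theorem utility_of_tendsto {u a b : ℕ → ℝ} {u' a' b' v : ℝ} (hv : 0 < v)
    (hu : Tendsto u atTop (𝓝 u')) (ha : Tendsto a atTop (𝓝 a')) (hb : Tendsto b atTop (𝓝 b'))
    (ha0 : ∀ k, 0 < a k) (hb0 : ∀ k, 0 < b k)
    (h : ∀ k, u k + Real.log v ≤ Real.log (a k) + Real.log (b k)) :
    0 < a' ∧ 0 < b' ∧ u' + Real.log v ≤ Real.log a' + Real.log b' := by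
  have h1 : Real.exp u' * v ≤ a' * b' := le_of_tendsto_of_tendsto'
    (((Real.continuous_exp.tendsto _).comp hu).mul_const v) (ha.mul hb)
    fun k => exp_mul_le_of_utility hv (ha0 k) (hb0 k) (h k)
  have h2 : 0 < a' * b' := lt_of_lt_of_le (by positivity) h1
  have ha' : 0 ≤ a' := ge_of_tendsto' ha fun k => (ha0 k).le
  have hb' : 0 ≤ b' := ge_of_tendsto' hb fun k => (hb0 k).le
  have ha1 : 0 < a' := ha'.lt_of_ne fun h => by simp [← h] at h2
  have hb1 : 0 < b' := hb'.lt_of_ne fun h => by simp [← h] at h2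
  exact ⟨ha1, hb1, le_of_tendsto_of_tendsto' (hu.add_const _)
    ((ha.log ha1.ne').add (hb.log hb1.ne')) h⟩

/-- Compactness is needed only for `J`, `X`, `α`, `R`, `lam`, since `β`, `E`, `I` are continuous
functions of these. The lower bound `c` prevents the logarithms from degenerating in the limit. -/
theorem exists_subseq_convergesTo (hS : S.Admissible) {J : ℕ → Fin S.NUE → ℝ} {x : ℕ → Vars S}
    {c : ℝ} (hJ : ∀ k, J k ∈ startSet S) (hx : ∀ k, (x k).SubFeasible (J k))
    (hc : ∀ k, c ≤ (x k).lam) :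
    ∃ φ : ℕ → ℕ, StrictMono φ ∧ ∃ J' ∈ startSet S, ∃ x' : Vars S,
      Tendsto (fun k => J (φ k)) atTop (𝓝 J') ∧ Vars.ConvergesTo (fun k => x (φ k)) x' ∧
      x'.SubFeasible J' := by
  obtain ⟨M, L, hML⟩ := exists_bound hS
  have hf : ∀ k, (x k).Feasible := fun k => (hx k).feasible hS (nonneg_of_mem_startSet (hJ k))
  have hC : IsCompact (startSet S ×ˢ budgetSet S ×ˢ Set.Icc (0 : Fin S.NUE → ℝ) 1 ×ˢ
      Set.Icc (0 : Fin S.NUE → ℝ) M ×ˢ Set.Icc c L) :=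
    (isCompact_startSet hS.η_pos).prod (isCompact_budgetSet.prod
      (isCompact_Icc.prod (isCompact_Icc.prod isCompact_Icc)))
  have : FirstCountableTopology (Precoders S) := inferInstanceAs (FirstCountableTopology
    (Fin S.NUE → (j : Fin S.NAP) → Fin (S.NA j) → Fin (S.NA j) → ℂ))
  obtain ⟨⟨J', X', α', R', lam'⟩, hmem, φ, hφ, hlim⟩ := hC.tendsto_subseq
    (x := fun k => (J k, (x k).X, (x k).α, (x k).R, (x k).lam))
    fun k => ⟨hJ k, (hx k).mem_budgetSet, ⟨fun i => ((hx k).ratio_mem i).1,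
      fun i => ((hx k).ratio_mem i).2⟩, ⟨fun i => ((hx k).R_pos i).le, (hML _ (hf k)).1⟩,
      hc k, (hML _ (hf k)).2⟩
  have hJl : Tendsto (fun k => J (φ k)) atTop (𝓝 J') := hlim.fst_nhds
  have hXl : Tendsto (fun k => (x (φ k)).X) atTop (𝓝 X') := hlim.snd_nhds.fst_nhds
  have hαl : Tendsto (fun k => (x (φ k)).α) atTop (𝓝 α') := hlim.snd_nhds.snd_nhds.fst_nhds
  have hRl : Tendsto (fun k => (x (φ k)).R) atTop (𝓝 R') :=
    hlim.snd_nhds.snd_nhds.snd_nhds.fst_nhds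
  have hll : Tendsto (fun k => (x (φ k)).lam) atTop (𝓝 lam') :=
    hlim.snd_nhds.snd_nhds.snd_nhds.snd_nhds
  obtain ⟨hJm, hXm, hαm, -, -⟩ := hmem
  have hβl : Tendsto (fun k => (x (φ k)).β) atTop (𝓝 (1 - α')) := by
    have : ∀ k, (x (φ k)).β = 1 - (x (φ k)).α := fun k => by
      funext i
      have := (hx (φ k)).add_eq_one i
      simp only [Pi.sub_apply, Pi.one_apply]; linarith
    simp only [this]
    exact tendsto_const_nhds.sub hαl
  have hEl : Tendsto (fun k => (x (φ k)).E) atTop (𝓝 (energy S X')) := by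
    have : ∀ k, (x (φ k)).E = energy S (x (φ k)).X := fun k => funext (hx (φ k)).E_eq
    simp only [this]
    exact ((continuous_pi fun i => continuous_energy i).tendsto _).comp hXl
  have hIl : Tendsto (fun k => (x (φ k)).I) atTop (𝓝 (interference S X')) := by
    have : ∀ k, (x (φ k)).I = interference S (x (φ k)).X := fun k => funext (hx (φ k)).I_eq
    simp only [this]
    exact ((continuous_pi fun i => continuous_interference i).tendsto _).comp hXl
  have hu1 := fun i => utility_of_tendsto (hS.v1_pos i) hll (tendsto_pi_nhds.1 hαl i)
    (tendsto_pi_nhds.1 hRl i) (fun k => (hx (φ k)).α_pos i) (fun k => (hx (φ k)).R_pos i)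
    fun k => (hx (φ k)).rate_utility i
  have hu2 := fun i => utility_of_tendsto (hS.v2_pos i) hll (tendsto_pi_nhds.1 hβl i)
    ((tendsto_pi_nhds.1 hEl i).const_mul (S.η i)) (fun k => (hx (φ k)).β_pos i)
    (fun k => mul_pos (hS.η_pos i) ((hx (φ k)).E_pos i)) fun k => (hx (φ k)).energy_utility i
  refine ⟨φ, hφ, J', hJm, ⟨X', α', 1 - α', R', energy S X', interference S X', lam'⟩, hJl,
    ⟨hXl, hαl, hβl, hRl, hEl, hIl, hll⟩, ⟨⟨⟨fun _ => rfl, fun _ => rfl, hXm.2, hXm.1,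
      fun i => by simp, fun i => ⟨hαm.1 i, hαm.2 i⟩⟩, fun i => (hu1 i).1, fun i => (hu2 i).1,
      fun i => (hu1 i).2.1, fun i => pos_of_mul_pos_right (hu2 i).2.1 (hS.η_pos i).le,
      fun i => (hu1 i).2.2, fun i => (hu2 i).2.2⟩, fun i => ?_⟩⟩
  have hJp := hS.add_sq_pos (nonneg_of_mem_startSet hJm i) i
  have hJi := (tendsto_pi_nhds.1 hJl i)
  have hJs := hJi.add_const (S.σ i ^ 2)
  have hEs := (tendsto_pi_nhds.1 hEl i).add_const (S.σ i ^ 2)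
  exact le_of_tendsto_of_tendsto' (tendsto_pi_nhds.1 hRl i)
    ((hEs.log (hS.add_sq_pos (energy_nonneg hXm.1 i) i).ne').sub ((hJs.log hJp.ne').add
      ((tendsto_const_nhds.div hJs hJp.ne').mul ((tendsto_pi_nhds.1 hIl i).sub hJi))))
    fun k => (hx (φ k)).rate i

theorem exists_subOptimal (hS : S.Admissible) {J : Fin S.NUE → ℝ} (hJ : J ∈ startSet S) :
    ∃ x : Vars S, x.SubOptimal J := by
  obtain ⟨M, L, hML⟩ := exists_bound hS
  have hJ0 := nonneg_of_mem_startSet hJ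
  set A : Set ℝ := {c | ∃ x : Vars S, x.SubFeasible J ∧ x.lam = c}
  have hne : A.Nonempty := let ⟨x, hx⟩ := exists_subFeasible hS hJ; ⟨x.lam, x, hx, rfl⟩
  have hbdd : BddAbove A := ⟨L, by rintro _ ⟨x, hx, rfl⟩; exact (hML x (hx.feasible hS hJ0)).2⟩
  obtain ⟨u, hum, hul, hu⟩ := exists_seq_tendsto_sSup hne hbdd
  choose x hx hxu using hu
  obtain ⟨φ, hφ, J', -, x', hJ', hx', hfeas⟩ := exists_subseq_convergesTo hS (J := fun _ => J)
    (x := x) (c := u 0) (fun _ => hJ) hx fun k => by rw [hxu]; exact hum (Nat.zero_le k)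
  obtain rfl := tendsto_nhds_unique hJ' tendsto_const_nhds
  have hlam : x'.lam = sSup A := by
    refine tendsto_nhds_unique hx'.lam ?_
    simp only [hxu]
    exact hul.comp hφ.tendsto_atTop
  exact ⟨x', hfeas, fun y hy => hlam ▸ le_csSup hbdd ⟨y, hy, rfl⟩⟩

/-! ### Dependence of the subproblem on the linearization point -/

/-- Lower semicontinuity of the value of the subproblem in the linearization point. -/
theorem Vars.SubFeasible.eventually_exists (hS : S.Admissible) {J : Fin S.NUE → ℝ}
    (hJ : ∀ i, 0 ≤ J i) {y : Vars S} (hy : y.SubFeasible J) {c : ℝ} (hc : c < y.lam)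
    {u : ℕ → Fin S.NUE → ℝ} (hu : Tendsto u atTop (𝓝 J)) :
    ∀ᶠ k in atTop, ∃ z : Vars S, z.SubFeasible (u k) ∧ c < z.lam := by
  -- Scaling `R` by `exp (-δ)` costs exactly `δ` of level and leaves strict room in every rate
  -- constraint, which survives a small change of `J`. Half of the surplus over `c` is spent.
  set δ : ℝ := (y.lam - c) / 2 with hδ
  have hδ0 : 0 < δ := by rw [hδ]; linarith
  have hs1 : Real.exp (-δ) < 1 := by rw [Real.exp_lt_one_iff]; linarith
  have hlim : ∀ i, ∀ᶠ k in atTop, Real.exp (-δ) * y.R i < Real.log (y.E i + S.σ i ^ 2) -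
      (Real.log (u k i + S.σ i ^ 2) + 1 / (u k i + S.σ i ^ 2) * (y.I i - u k i)) := fun i => by
    have hJp := hS.add_sq_pos (hJ i) i
    have hJi := (tendsto_pi_nhds.1 hu i)
    have hJs := hJi.add_const (S.σ i ^ 2)
    have : Tendsto (fun k => Real.log (y.E i + S.σ i ^ 2) -
        (Real.log (u k i + S.σ i ^ 2) + 1 / (u k i + S.σ i ^ 2) * (y.I i - u k i))) atTop _ :=
      (tendsto_const_nhds (x := Real.log (y.E i + S.σ i ^ 2))).sub ((hJs.log hJp.ne').add
        ((tendsto_const_nhds.div hJs hJp.ne').mul (tendsto_const_nhds.sub hJi)))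
    refine this.eventually (lt_mem_nhds (lt_of_lt_of_le ?_ (hy.rate i)))
    have := hy.R_pos i
    nlinarith
  filter_upwards [eventually_all.2 hlim] with k hk
  refine ⟨{ y with R := Real.exp (-δ) • y.R, lam := y.lam - δ },
    ⟨⟨⟨hy.E_eq, hy.I_eq, hy.power_le, hy.psd, hy.add_eq_one, hy.ratio_mem⟩, hy.α_pos, hy.β_pos,
      fun i => mul_pos (Real.exp_pos _) (hy.R_pos i), hy.E_pos, fun i => ?_, fun i => ?_⟩,
      fun i => (hk i).le⟩, ?_⟩
  · have := hy.rate_utility i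
    simp only [Pi.smul_apply, smul_eq_mul]
    rw [Real.log_mul (Real.exp_pos _).ne' (hy.R_pos i).ne', Real.log_exp]
    linarith
  · have := hy.energy_utility i
    dsimp only; linarith
  · dsimp only; rw [hδ]; linarith

/-! ### Multipliers of the subproblem -/

/-- Slack of the rate utility constraint. -/
noncomputable def rateUtilitySlack (lam : ℝ) (α R : Fin S.NUE → ℝ) (i : Fin S.NUE) : ℝ :=
  Real.log (α i) + Real.log (R i) - (lam + Real.log (S.v1 i))

/-- Slack of the energy utility constraint. -/
noncomputable def energyUtilitySlack (lam : ℝ) (X : Precoders S) (α : Fin S.NUE → ℝ)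
    (i : Fin S.NUE) : ℝ :=
  Real.log (1 - α i) + Real.log (S.η i * energy S X i) - (lam + Real.log (S.v2 i))

/-- Slack of the rate constraint linearized at `J`. -/
noncomputable def rateSlack (J : Fin S.NUE → ℝ) (X : Precoders S) (R : Fin S.NUE → ℝ)
    (i : Fin S.NUE) : ℝ :=
  Real.log (energy S X i + S.σ i ^ 2) - (Real.log (J i + S.σ i ^ 2) +
    1 / (J i + S.σ i ^ 2) * (interference S X i - J i)) - R i

variable (S) in
/-- The domain of the subproblem in the independent variables `X`, `α`, `R`. -/
def domain : Set (Precoders S × (Fin S.NUE → ℝ) × (Fin S.NUE → ℝ)) :=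
  {v | v.1 ∈ psdCone S ∧ ∀ i, 0 < energy S v.1 i ∧ 0 < v.2.1 i ∧ v.2.1 i < 1 ∧ 0 < v.2.2 i}

theorem pos_combination {a b s t : ℝ} (ha : 0 < a) (hb : 0 < b) (hs : 0 ≤ s) (ht : 0 ≤ t)
    (hst : s + t = 1) : 0 < s * a + t * b :=
  Set.mem_Ioi.1 (convex_Ioi (0 : ℝ) ha hb hs ht hst)

theorem convex_domain : Convex ℝ (domain S) := by
  rintro ⟨X, α, R⟩ ⟨hX, h⟩ ⟨X', α', R'⟩ ⟨hX', h'⟩ s t hs ht hst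
  refine ⟨add_mem_psdCone (smul_mem_psdCone hs hX) (smul_mem_psdCone ht hX'), fun i => ?_⟩
  obtain ⟨h1, h2, h3, h4⟩ := h i
  obtain ⟨h1', h2', h3', h4'⟩ := h' i
  simp only at *
  refine ⟨?_, pos_combination h2 h2' hs ht hst, ?_, pos_combination h4 h4' hs ht hst⟩
  · simpa only [Prod.fst_add, Prod.smul_fst, energy_add, energy_smul] using
      pos_combination h1 h1' hs ht hst
  · have := pos_combination (sub_pos.2 h3) (sub_pos.2 h3') hs ht hst
    simp only [Prod.snd_add, Prod.fst_add, Prod.smul_snd, Prod.smul_fst, Pi.add_apply,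
      Pi.smul_apply, smul_eq_mul]
    linarith

theorem concaveOn_rateUtilitySlack (lam : ℝ) (i : Fin S.NUE) :
    ConcaveOn ℝ (domain S) fun v => rateUtilitySlack lam v.2.1 v.2.2 i := by
  refine ⟨convex_domain, ?_⟩
  rintro ⟨X, α, R⟩ ⟨hX, h⟩ ⟨X', α', R'⟩ ⟨hX', h'⟩ s t hs ht hst
  have h1 := log_concave (h i).2.1 (h' i).2.1 hs ht hst
  have h2 := log_concave (h i).2.2.2 (h' i).2.2.2 hs ht hst
  simp only [rateUtilitySlack, Prod.snd_add, Prod.fst_add, Prod.smul_snd, Prod.smul_fst,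
    Pi.add_apply, Pi.smul_apply, smul_eq_mul] at *
  obtain rfl : t = 1 - s := by linarith
  linarith

theorem concaveOn_energyUtilitySlack (hS : S.Admissible) (lam : ℝ) (i : Fin S.NUE) :
    ConcaveOn ℝ (domain S) fun v => energyUtilitySlack lam v.1 v.2.1 i := by
  refine ⟨convex_domain, ?_⟩
  rintro ⟨X, α, R⟩ ⟨hX, h⟩ ⟨X', α', R'⟩ ⟨hX', h'⟩ s t hs ht hst
  have h1 := log_concave (sub_pos.2 (h i).2.2.1) (sub_pos.2 (h' i).2.2.1) hs ht hst
  have h2 := log_concave (mul_pos (hS.η_pos i) (h i).1) (mul_pos (hS.η_pos i) (h' i).1) hs ht hst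
  simp only [energyUtilitySlack, Prod.snd_add, Prod.fst_add, Prod.smul_snd, Prod.smul_fst,
    Pi.add_apply, Pi.smul_apply, smul_eq_mul, energy_add, energy_smul] at *
  obtain rfl : t = 1 - s := by linarith
  have e1 : 1 - (s * α i + (1 - s) * α' i) = s * (1 - α i) + (1 - s) * (1 - α' i) := by ring
  have e2 : S.η i * (s * energy S X i + (1 - s) * energy S X' i) =
    s * (S.η i * energy S X i) + (1 - s) * (S.η i * energy S X' i) := by ring
  rw [e1, e2]
  linarith

theorem concaveOn_rateSlack (hS : S.Admissible) (J : Fin S.NUE → ℝ) (i : Fin S.NUE) :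
    ConcaveOn ℝ (domain S) fun v => rateSlack J v.1 v.2.2 i := by
  refine ⟨convex_domain, ?_⟩
  rintro ⟨X, α, R⟩ ⟨hX, h⟩ ⟨X', α', R'⟩ ⟨hX', h'⟩ s t hs ht hst
  have h1 := log_concave (hS.add_sq_pos (h i).1.le i) (hS.add_sq_pos (h' i).1.le i) hs ht hst
  simp only [rateSlack, Prod.snd_add, Prod.fst_add, Prod.smul_snd, Prod.smul_fst,
    Pi.add_apply, Pi.smul_apply, smul_eq_mul, energy_add, energy_smul, interference_add,
    interference_smul] at *
  obtain rfl : t = 1 - s := by linarith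
  have e1 : s * energy S X i + (1 - s) * energy S X' i + S.σ i ^ 2 =
    s * (energy S X i + S.σ i ^ 2) + (1 - s) * (energy S X' i + S.σ i ^ 2) := by ring
  rw [e1]
  linarith

theorem concaveOn_powerSlack :
    ConcaveOn ℝ (domain S) fun v => S.Pmax - power S v.1 := by
  refine ⟨convex_domain, ?_⟩
  rintro ⟨X, α, R⟩ ⟨hX, h⟩ ⟨X', α', R'⟩ ⟨hX', h'⟩ s t hs ht hst
  simp only [Prod.fst_add, Prod.smul_fst, smul_eq_mul, power_add, power_smul]
  obtain rfl : t = 1 - s := by linarith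
  linarith

/-- The Lagrangian of the subproblem at the fixed level `lam`. -/
noncomputable def levelLagrangian (J : Fin S.NUE → ℝ) (lam : ℝ) (a b μ : Fin S.NUE → ℝ) (p : ℝ)
    (v : Precoders S × (Fin S.NUE → ℝ) × (Fin S.NUE → ℝ)) : ℝ :=
  ∑ i, (a i * rateUtilitySlack lam v.2.1 v.2.2 i + b i * energyUtilitySlack lam v.1 v.2.1 i +
    μ i * rateSlack J v.1 v.2.2 i) + p * (S.Pmax - power S v.1)

/-- The linear functional `Y ↦ ∑ (e i) E i - ∑ (f i) I i - p power` of the precoders. -/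
noncomputable def weighted (e f : Fin S.NUE → ℝ) (p : ℝ) (Y : Precoders S) : ℝ :=
  ∑ i, (e i * energy S Y i - f i * interference S Y i) - p * power S Y

/-- Weight of the received energy in the derivative of the Lagrangian. -/
noncomputable def energyWeight (x : Vars S) (b μ : Fin S.NUE → ℝ) (i : Fin S.NUE) : ℝ :=
  b i / x.E i + μ i / (x.E i + S.σ i ^ 2)

/-- Weight of the interference in the derivative of the Lagrangian. -/
noncomputable def interfWeight (J μ : Fin S.NUE → ℝ) (i : Fin S.NUE) : ℝ :=
  μ i / (J i + S.σ i ^ 2)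

/-- Karush-Kuhn-Tucker conditions of the subproblem linearized at `J`, in the independent variables
`X`, `α`, `R`, up to the normalization of the multipliers. -/
structure SubKKT (J : Fin S.NUE → ℝ) (x : Vars S) (a b μ : Fin S.NUE → ℝ) (p : ℝ) : Prop where
  a_nonneg : ∀ i, 0 ≤ a i
  b_nonneg : ∀ i, 0 ≤ b i
  μ_nonneg : ∀ i, 0 ≤ μ i
  p_nonneg : 0 ≤ p
  a_slack : ∀ i, a i * rateUtilitySlack x.lam x.α x.R i = 0
  b_slack : ∀ i, b i * energyUtilitySlack x.lam x.X x.α i = 0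
  μ_slack : ∀ i, μ i * rateSlack J x.X x.R i = 0
  p_slack : p * (S.Pmax - power S x.X) = 0
  ratio : ∀ i, a i / x.α i = b i / x.β i
  rate : ∀ i, a i / x.R i = μ i
  weighted_nonpos : ∀ Y ∈ psdCone S, weighted (energyWeight x b μ) (interfWeight J μ) p Y ≤ 0
  weighted_eq : weighted (energyWeight x b μ) (interfWeight J μ) p x.X = 0

theorem Vars.Common.α_lt_one {x : Vars S} (h : x.Common) (i : Fin S.NUE) : x.α i < 1 := by
  linarith [h.add_eq_one i, h.β_pos i]

theorem Vars.Common.β_eq {x : Vars S} (h : x.Common) (i : Fin S.NUE) : 1 - x.α i = x.β i := by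
  linarith [h.add_eq_one i]

theorem Vars.Common.mem_domain {x : Vars S} (h : x.Common) : (x.X, x.α, x.R) ∈ domain S :=
  ⟨h.psd, fun i => ⟨h.E_eq i ▸ h.E_pos i, h.α_pos i, h.α_lt_one i, h.R_pos i⟩⟩

theorem hasDerivAt_affine (a b : ℝ) : HasDerivAt (fun t : ℝ => a + t * b) b 0 := by
  simpa using ((hasDerivAt_id (0 : ℝ)).mul_const b).const_add a

theorem hasDerivAt_log_affine {a b : ℝ} (ha : a ≠ 0) :
    HasDerivAt (fun t : ℝ => Real.log (a + t * b)) (b / a) 0 := by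
  simpa using (hasDerivAt_affine a b).log (by simpa using ha)

theorem hasDerivAt_levelLagrangian (hS : S.Admissible) {J : Fin S.NUE → ℝ} {x : Vars S}
    (h : x.Common) (lam : ℝ) (a b μ : Fin S.NUE → ℝ) (p : ℝ) (Y : Precoders S)
    (δα δR : Fin S.NUE → ℝ) :
    HasDerivAt (fun t : ℝ => levelLagrangian J lam a b μ p
        (x.X + t • Y, x.α + t • δα, x.R + t • δR))
      (∑ i, (δα i * (a i / x.α i - b i / x.β i) + δR i * (a i / x.R i - μ i)) +
        weighted (energyWeight x b μ) (interfWeight J μ) p Y) 0 := by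
  have hE : ∀ i (t : ℝ), energy S (x.X + t • Y) i = x.E i + t * energy S Y i := fun i t => by
    rw [energy_add, energy_smul, h.E_eq]
  have h1 : ∀ i, HasDerivAt (fun t : ℝ => rateUtilitySlack lam (x.α + t • δα) (x.R + t • δR) i)
      (δα i / x.α i + δR i / x.R i) 0 := fun i => by
    simp only [rateUtilitySlack, Pi.add_apply, Pi.smul_apply, smul_eq_mul]
    exact ((hasDerivAt_log_affine (h.α_pos i).ne').add
      (hasDerivAt_log_affine (h.R_pos i).ne')).sub_const _
  have h2 : ∀ i, HasDerivAt (fun t : ℝ => energyUtilitySlack lam (x.X + t • Y) (x.α + t • δα) i)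
      (-δα i / x.β i + energy S Y i / x.E i) 0 := fun i => by
    have e1 : ∀ t : ℝ, 1 - (x.α i + t * δα i) = x.β i + t * -δα i := fun t => by
      rw [← h.β_eq]; ring
    have e2 : ∀ t : ℝ, S.η i * (x.E i + t * energy S Y i) =
      S.η i * x.E i + t * (S.η i * energy S Y i) := fun t => by ring
    simp only [energyUtilitySlack, Pi.add_apply, Pi.smul_apply, smul_eq_mul, hE, e1, e2]
    have h3 := hasDerivAt_log_affine (b := S.η i * energy S Y i)
      (mul_pos (hS.η_pos i) (h.E_pos i)).ne'
    rw [mul_div_mul_left _ _ (hS.η_pos i).ne'] at h3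
    exact ((hasDerivAt_log_affine (h.β_pos i).ne').add h3).sub_const _
  have h3 : ∀ i, HasDerivAt (fun t : ℝ => rateSlack J (x.X + t • Y) (x.R + t • δR) i)
      (energy S Y i / (x.E i + S.σ i ^ 2) -
        1 / (J i + S.σ i ^ 2) * interference S Y i - δR i) 0 := fun i => by
    have e1 : ∀ t : ℝ, x.E i + t * energy S Y i + S.σ i ^ 2 =
      x.E i + S.σ i ^ 2 + t * energy S Y i := fun t => by ring
    have e2 : ∀ t : ℝ, interference S (x.X + t • Y) i - J i =
      x.I i - J i + t * interference S Y i := fun t => by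
        rw [interference_add, interference_smul, h.I_eq]; ring
    simp only [rateSlack, Pi.add_apply, Pi.smul_apply, smul_eq_mul, hE, e1, e2]
    exact ((hasDerivAt_log_affine (hS.add_sq_pos (h.E_pos i).le i).ne').sub
      (((hasDerivAt_affine _ _).const_mul _).const_add _)).sub (hasDerivAt_affine _ _)
  have h4 : HasDerivAt (fun t : ℝ => S.Pmax - power S (x.X + t • Y)) (-power S Y) 0 := by
    simp only [power_add, power_smul]
    exact (hasDerivAt_affine _ _).const_sub _
  have h5 := (HasDerivAt.fun_sum (u := Finset.univ) fun i _ =>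
    (((h1 i).const_mul (a i)).add ((h2 i).const_mul (b i))).add ((h3 i).const_mul (μ i))).add
      (h4.const_mul p)
  refine h5.congr_deriv (Eq.symm ?_)
  rw [weighted, ← add_sub_assoc, ← Finset.sum_add_distrib, mul_neg, ← sub_eq_add_neg]
  congr 1
  refine Finset.sum_congr rfl fun i _ => ?_
  simp only [energyWeight, interfWeight]
  ring

theorem weighted_smul (e f : Fin S.NUE → ℝ) (p t : ℝ) (Y : Precoders S) :
    weighted e f p (t • Y) = t * weighted e f p Y := by
  simp only [weighted, energy_smul, interference_smul, power_smul, mul_sub, Finset.mul_sum]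
  congr 1
  · exact Finset.sum_congr rfl fun i _ => by ring
  · ring

theorem weighted_add (e f : Fin S.NUE → ℝ) (p : ℝ) (X Y : Precoders S) :
    weighted e f p (X + Y) = weighted e f p X + weighted e f p Y := by
  simp only [weighted, energy_add, interference_add, power_add, mul_add]
  rw [sub_add_sub_comm, ← Finset.sum_add_distrib]
  congr 1
  exact Finset.sum_congr rfl fun i _ => by ring

theorem Vars.SubFeasible.rateUtilitySlack_nonneg {J : Fin S.NUE → ℝ} {x : Vars S}
    (h : x.SubFeasible J) (i : Fin S.NUE) : 0 ≤ rateUtilitySlack x.lam x.α x.R i :=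
  sub_nonneg.2 (h.rate_utility i)

theorem Vars.SubFeasible.energyUtilitySlack_nonneg {J : Fin S.NUE → ℝ} {x : Vars S}
    (h : x.SubFeasible J) (i : Fin S.NUE) : 0 ≤ energyUtilitySlack x.lam x.X x.α i := by
  rw [energyUtilitySlack, h.β_eq, ← h.E_eq]
  exact sub_nonneg.2 (h.energy_utility i)

theorem Vars.SubFeasible.rateSlack_nonneg {J : Fin S.NUE → ℝ} {x : Vars S}
    (h : x.SubFeasible J) (i : Fin S.NUE) : 0 ≤ rateSlack J x.X x.R i := by
  rw [rateSlack, ← h.E_eq, ← h.I_eq]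
  exact sub_nonneg.2 (h.rate i)

/-- At `x` every term of the level Lagrangian is nonnegative, so the bound makes each term vanish
and makes `x` a maximizer over the domain. The remaining claims are its first-order conditions. -/
theorem subKKT_of_levelLagrangian_nonpos (hS : S.Admissible) {J : Fin S.NUE → ℝ} {x : Vars S}
    (h : x.SubFeasible J) {a b μ : Fin S.NUE → ℝ} {p : ℝ} (ha : ∀ i, 0 ≤ a i) (hb : ∀ i, 0 ≤ b i)
    (hμ : ∀ i, 0 ≤ μ i) (hp : 0 ≤ p)
    (hL : ∀ v ∈ domain S, levelLagrangian J x.lam a b μ p v ≤ 0) : SubKKT J x a b μ p := by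
  have ta : ∀ i, 0 ≤ a i * rateUtilitySlack x.lam x.α x.R i :=
    fun i => mul_nonneg (ha i) (h.rateUtilitySlack_nonneg i)
  have tb : ∀ i, 0 ≤ b i * energyUtilitySlack x.lam x.X x.α i :=
    fun i => mul_nonneg (hb i) (h.energyUtilitySlack_nonneg i)
  have tμ : ∀ i, 0 ≤ μ i * rateSlack J x.X x.R i :=
    fun i => mul_nonneg (hμ i) (h.rateSlack_nonneg i)
  have tp : 0 ≤ p * (S.Pmax - power S x.X) := mul_nonneg hp (sub_nonneg.2 h.power_le)
  have tsum : ∀ i ∈ Finset.univ, 0 ≤ a i * rateUtilitySlack x.lam x.α x.R i +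
    b i * energyUtilitySlack x.lam x.X x.α i + μ i * rateSlack J x.X x.R i :=
    fun i _ => add_nonneg (add_nonneg (ta i) (tb i)) (tμ i)
  have hL0 := hL _ h.mem_domain
  rw [levelLagrangian] at hL0
  have hs := Finset.sum_nonneg tsum
  have hs0 := (Finset.sum_eq_zero_iff_of_nonneg tsum).1 (by linarith)
  have hLx : levelLagrangian J x.lam a b μ p (x.X, x.α, x.R) = 0 := by
    rw [levelLagrangian]; linarith
  have hder : ∀ (Y : Precoders S) (δα δR : Fin S.NUE → ℝ),
      (∀ᶠ t in 𝓝[>] (0 : ℝ), x.X + t • Y ∈ psdCone S) →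
      ∑ i, (δα i * (a i / x.α i - b i / x.β i) + δR i * (a i / x.R i - μ i)) +
        weighted (energyWeight x b μ) (interfWeight J μ) p Y ≤ 0 := fun Y δα δR hY => by
    refine deriv_nonpos_of_eventually_le
      (hasDerivAt_levelLagrangian hS h.toCommon x.lam a b μ p Y δα δR) ?_
    have haff : ∀ u w : ℝ, Tendsto (fun t : ℝ => u + t * w) (𝓝[>] 0) (𝓝 u) := fun u w => by
      have : Tendsto (fun t : ℝ => u + t * w) (𝓝 0) (𝓝 (u + 0 * w)) :=
        Continuous.tendsto (by fun_prop) 0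
      rw [zero_mul, add_zero] at this
      exact this.mono_left nhdsWithin_le_nhds
    have hdom : ∀ i, ∀ᶠ t in 𝓝[>] (0 : ℝ), 0 < energy S (x.X + t • Y) i ∧
        0 < (x.α + t • δα) i ∧ (x.α + t • δα) i < 1 ∧ 0 < (x.R + t • δR) i := fun i => by
      simp only [energy_add, energy_smul, ← h.E_eq, Pi.add_apply, Pi.smul_apply, smul_eq_mul]
      exact ((haff _ _).eventually (lt_mem_nhds (h.E_pos i))).and
        (((haff _ _).eventually (lt_mem_nhds (h.α_pos i))).and
        (((haff _ _).eventually (gt_mem_nhds (h.α_lt_one i))).and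
        ((haff _ _).eventually (lt_mem_nhds (h.R_pos i)))))
    filter_upwards [hY, eventually_all.2 hdom] with t ht1 ht2
    have h0 : (x.X + (0 : ℝ) • Y, x.α + (0 : ℝ) • δα, x.R + (0 : ℝ) • δR) = (x.X, x.α, x.R) := by
      simp
    rw [h0, hLx]
    exact hL _ ⟨ht1, ht2⟩
  have hw0 : weighted (energyWeight x b μ) (interfWeight J μ) p 0 = 0 := by
    simpa using weighted_smul (energyWeight x b μ) (interfWeight J μ) p 0 0
  -- In the open variables `α` and `R` the gradient itself is an admissible direction, which gives a
  -- sum of squares `≤ 0`.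
  have hsq := hder 0 (fun i => a i / x.α i - b i / x.β i) (fun i => a i / x.R i - μ i)
    (by simp only [smul_zero, add_zero]; exact Eventually.of_forall fun _ => h.psd)
  rw [hw0, add_zero] at hsq
  have hsq0 := (Finset.sum_eq_zero_iff_of_nonneg fun i _ => by
    nlinarith [mul_self_nonneg (a i / x.α i - b i / x.β i),
      mul_self_nonneg (a i / x.R i - μ i)]).1 (le_antisymm hsq (Finset.sum_nonneg fun i _ =>
      add_nonneg (mul_self_nonneg _) (mul_self_nonneg _)))
  have hw : ∀ Y : Precoders S, (∀ᶠ t in 𝓝[>] (0 : ℝ), x.X + t • Y ∈ psdCone S) →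
      weighted (energyWeight x b μ) (interfWeight J μ) p Y ≤ 0 := fun Y hY => by
    simpa using hder Y 0 0 hY
  have hw1 : ∀ Y ∈ psdCone S, weighted (energyWeight x b μ) (interfWeight J μ) p Y ≤ 0 :=
    fun Y hY => hw Y (eventually_nhdsWithin_of_forall fun t ht =>
      add_mem_psdCone h.psd (smul_mem_psdCone (le_of_lt ht) hY))
  refine ⟨ha, hb, hμ, hp, fun i => ?_, fun i => ?_, fun i => ?_, by linarith, fun i => ?_,
    fun i => ?_, hw1, le_antisymm (hw1 _ h.psd) ?_⟩
  · linarith [hs0 i (Finset.mem_univ i), ta i, tb i, tμ i]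
  · linarith [hs0 i (Finset.mem_univ i), ta i, tb i, tμ i]
  · linarith [hs0 i (Finset.mem_univ i), ta i, tb i, tμ i]
  · have := hsq0 i (Finset.mem_univ i)
    nlinarith [mul_self_nonneg (a i / x.α i - b i / x.β i), mul_self_nonneg (a i / x.R i - μ i)]
  · have := hsq0 i (Finset.mem_univ i)
    nlinarith [mul_self_nonneg (a i / x.α i - b i / x.β i), mul_self_nonneg (a i / x.R i - μ i)]
  -- Shrinking all beams is also admissible, since `(1 - t) • x.X` stays in the cone for `t < 1`.
  -- This yields the reverse inequality.
  · have := hw ((-1 : ℝ) • x.X) (by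
      filter_upwards [(gt_mem_nhds (one_pos (α := ℝ))).filter_mono nhdsWithin_le_nhds] with t ht
      have : x.X + t • (-1 : ℝ) • x.X = (1 - t) • x.X := by module
      rw [this]
      exact smul_mem_psdCone (by linarith) h.psd)
    rw [weighted_smul] at this
    linarith

/-- This takes the place of a constraint qualification. If `a` and `b` vanish, stationarity in `R`
gives `μ = 0`. Then the beams have total price `p * power = 0`, and power slackness gives `p * Pmax
= 0`. -/
theorem SubKKT.sum_pos (hS : S.Admissible) {J : Fin S.NUE → ℝ} {x : Vars S}
    {a b μ : Fin S.NUE → ℝ} {p : ℝ} (h : SubKKT J x a b μ p)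
    (hne : ¬(a = 0 ∧ b = 0 ∧ μ = 0 ∧ p = 0)) : 0 < ∑ i, (a i + b i) := by
  have hnn : ∀ i ∈ Finset.univ, 0 ≤ a i + b i := fun i _ => add_nonneg (h.a_nonneg i) (h.b_nonneg i)
  refine (Finset.sum_nonneg hnn).lt_of_ne fun h0 => hne ?_
  have h1 := (Finset.sum_eq_zero_iff_of_nonneg hnn).1 h0.symm
  have ha : a = 0 := funext fun i => by
    have := h1 i (Finset.mem_univ i)
    have := h.a_nonneg i
    have := h.b_nonneg i
    simp only [Pi.zero_apply]; linarith
  have hb : b = 0 := funext fun i => by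
    have := h1 i (Finset.mem_univ i)
    have := h.a_nonneg i
    have := h.b_nonneg i
    simp only [Pi.zero_apply]; linarith
  have hμ : μ = 0 := funext fun i => by rw [← h.rate i, ha]; simp
  refine ⟨ha, hb, hμ, ?_⟩
  have h2 := h.weighted_eq
  have h3 := h.p_slack
  rw [hb, hμ] at h2
  simp only [weighted, energyWeight, interfWeight, Pi.zero_apply, zero_div, add_zero, zero_mul,
    sub_zero, Finset.sum_const_zero, zero_sub, neg_eq_zero] at h2
  rw [mul_sub, h2, sub_zero] at h3
  exact (mul_eq_zero.1 h3).resolve_right hS.Pmax_pos.ne'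

/-- Optimal solutions of the subproblem satisfy its Karush-Kuhn-Tucker conditions. -/
theorem Vars.SubOptimal.exists_subKKT (hS : S.Admissible) {J : Fin S.NUE → ℝ} {x : Vars S}
    (hx : x.SubOptimal J) :
    ∃ (a b μ : Fin S.NUE → ℝ) (p : ℝ), SubKKT J x a b μ p ∧ ∑ i, (a i + b i) = 1 := by
  obtain ⟨hf, hopt⟩ := hx
  obtain ⟨c, hc, hc0, hcL⟩ := exists_nonneg_combination_nonpos
    (ι := (Fin S.NUE ⊕ Fin S.NUE) ⊕ (Fin S.NUE ⊕ Unit)) (D := domain S) ⟨_, hf.mem_domain⟩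
    (f := Sum.elim (Sum.elim (fun i v => rateUtilitySlack x.lam v.2.1 v.2.2 i)
        fun i v => energyUtilitySlack x.lam v.1 v.2.1 i)
      (Sum.elim (fun i v => rateSlack J v.1 v.2.2 i) fun _ v => S.Pmax - power S v.1)) (by
      rintro ((i | i) | (i | i))
      · exact concaveOn_rateUtilitySlack _ i
      · exact concaveOn_energyUtilitySlack hS _ i
      · exact concaveOn_rateSlack hS J i
      · exact concaveOn_powerSlack) convex_domain (by
      rintro ⟨X, α, R⟩ ⟨hX, hv⟩
      by_contra! hpos
      have h1 : ∀ i, 0 < rateUtilitySlack x.lam α R i := fun i => hpos (.inl (.inl i))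
      have h2 : ∀ i, 0 < energyUtilitySlack x.lam X α i := fun i => hpos (.inl (.inr i))
      have h3 : ∀ i, 0 < rateSlack J X R i := fun i => hpos (.inr (.inl i))
      have h4 : 0 < S.Pmax - power S X := hpos (.inr (.inr ()))
      -- If all slacks were positive at a point of the domain, the level could be raised by a small
      -- `ε`, contradicting optimality.
      have h5 : ∀ᶠ ε in 𝓝[>] (0 : ℝ), (∀ i, ε < rateUtilitySlack x.lam α R i) ∧
          (∀ i, ε < energyUtilitySlack x.lam X α i) :=
        ((eventually_all.2 fun i => gt_mem_nhds (h1 i)).and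
          (eventually_all.2 fun i => gt_mem_nhds (h2 i))).filter_mono nhdsWithin_le_nhds
      obtain ⟨ε, ⟨hε1, hε2⟩, hε0⟩ := (h5.and self_mem_nhdsWithin).exists
      have hle := hopt ⟨X, α, fun i => 1 - α i, R, energy S X, interference S X, x.lam + ε⟩
        ⟨⟨⟨fun _ => rfl, fun _ => rfl, by dsimp only; linarith, hX, fun i => by dsimp only; ring,
          fun i => ⟨(hv i).2.1.le, (hv i).2.2.1.le⟩⟩, fun i => (hv i).2.1,
          fun i => sub_pos.2 (hv i).2.2.1, fun i => (hv i).2.2.2, fun i => (hv i).1,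
          fun i => ?_, fun i => ?_⟩, fun i => ?_⟩
      · have : (0 : ℝ) < ε := hε0
        dsimp only at hle; linarith
      · have := hε1 i
        simp only [rateUtilitySlack] at this
        dsimp only; linarith
      · have := hε2 i
        simp only [energyUtilitySlack] at this
        dsimp only; linarith
      · have := h3 i
        simp only [rateSlack] at this
        dsimp only; linarith)
  set a : Fin S.NUE → ℝ := fun i => c (.inl (.inl i)) with ha
  set b : Fin S.NUE → ℝ := fun i => c (.inl (.inr i)) with hb
  set μ : Fin S.NUE → ℝ := fun i => c (.inr (.inl i)) with hμ
  set p : ℝ := c (.inr (.inr ())) with hp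
  have hL : ∀ v ∈ domain S, levelLagrangian J x.lam a b μ p v ≤ 0 := fun v hv => by
    have := hcL v hv
    simp only [Fintype.sum_sum_type, Sum.elim_inl, Sum.elim_inr, Finset.univ_unique,
      Finset.sum_singleton] at this
    rw [levelLagrangian, Finset.sum_add_distrib, Finset.sum_add_distrib, add_assoc _ _ (p * _)]
    exact this
  have hK := subKKT_of_levelLagrangian_nonpos hS hf (fun i => hc _) (fun i => hc _)
    (fun i => hc _) (hc _) hL
  have hs : 0 < ∑ i, (a i + b i) := hK.sum_pos hS fun ⟨h1, h2, h3, h4⟩ => hc0 (by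
    funext k
    rcases k with ((i | i) | (i | i))
    · exact congrFun h1 i
    · exact congrFun h2 i
    · exact congrFun h3 i
    · exact h4)
  set s := (∑ i, (a i + b i))⁻¹ with hsdef
  have hs0 : 0 ≤ s := inv_nonneg.2 hs.le
  refine ⟨fun i => s * a i, fun i => s * b i, fun i => s * μ i, s * p,
    subKKT_of_levelLagrangian_nonpos hS hf (fun i => mul_nonneg hs0 (hc _))
      (fun i => mul_nonneg hs0 (hc _)) (fun i => mul_nonneg hs0 (hc _)) (mul_nonneg hs0 (hc _))
      fun v hv => ?_, ?_⟩
  · have : levelLagrangian J x.lam (fun i => s * a i) (fun i => s * b i) (fun i => s * μ i)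
        (s * p) v = s * levelLagrangian J x.lam a b μ p v := by
      simp only [levelLagrangian, mul_add, Finset.mul_sum, mul_assoc]
    rw [this]
    exact mul_nonpos_of_nonneg_of_nonpos hs0 (hL v hv)
  · simp only [← mul_add, ← Finset.mul_sum]
    exact inv_mul_cancel₀ hs.ne'

/-! ### From subproblem multipliers to stationary points -/

theorem sum_ite_eq_interference (r : Fin S.NUE → ℝ) (i : Fin S.NUE) :
    ∑ l, (if i = l then 0 else r l) = ∑ l ∈ Finset.univ.erase i, r l := by
  rw [← Finset.sum_erase_add _ _ (Finset.mem_univ i), if_pos rfl, add_zero]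
  exact Finset.sum_congr rfl fun l hl => if_neg (Finset.ne_of_mem_erase hl).symm

/-- The functional `weighted` is the sum of its values on the beams of the single users. -/
theorem sum_weighted_single (e f : Fin S.NUE → ℝ) (p : ℝ) (Y : Precoders S) :
    ∑ l, weighted e f p (Pi.single l (Y l)) = weighted e f p Y := by
  simp only [weighted, energy_single, interference_single, power_single]
  rw [Finset.sum_sub_distrib, Finset.sum_comm, ← Finset.mul_sum]
  congr 1
  · refine Finset.sum_congr rfl fun i _ => ?_
    rw [Finset.sum_sub_distrib, ← Finset.mul_sum, ← Finset.mul_sum, ← energy_eq_sum,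
      sum_ite_eq_interference, ← interference_eq_sum]
  · rw [power, Finset.sum_comm]

/-- The matrix representing `- weighted e f p` on the beam of user `l` at access point `j`. -/
noncomputable def dualMatrix (e f : Fin S.NUE → ℝ) (p : ℝ) : Precoders S := fun l j =>
  p • (1 : Matrix _ _ ℂ) - ∑ i, (e i - if i = l then 0 else f i) • chan S i j

theorem trace_dualMatrix_mul (e f : Fin S.NUE → ℝ) (p : ℝ) (l : Fin S.NUE)
    (A : ∀ j, Matrix (Fin (S.NA j)) (Fin (S.NA j)) ℂ) :
    ∑ j, (Matrix.trace (dualMatrix e f p l j * A j)).re = -weighted e f p (Pi.single l A) := by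
  have h : ∀ j, (Matrix.trace (dualMatrix e f p l j * A j)).re = p * (A j).trace.re -
      ∑ i, (e i - if i = l then 0 else f i) * (Matrix.trace (chan S i j * A j)).re := fun j => by
    simp only [dualMatrix, sub_mul, Finset.sum_mul, Matrix.smul_mul, one_mul, Matrix.trace_sub,
      Matrix.trace_sum, Matrix.trace_smul, Complex.sub_re, Complex.re_sum, Complex.real_smul,
      Complex.re_ofReal_mul]
  simp only [h, weighted, energy_single, interference_single, power_single]
  rw [Finset.sum_sub_distrib, Finset.sum_comm, ← Finset.mul_sum, neg_sub]
  congr 1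
  refine Finset.sum_congr rfl fun i _ => ?_
  rw [← Finset.mul_sum, received]
  split_ifs <;> ring

theorem sum_trace_dualMatrix_mul (e f : Fin S.NUE → ℝ) (p : ℝ) (Y : Precoders S) :
    ∑ l, ∑ j, (Matrix.trace (dualMatrix e f p l j * Y l j)).re = -weighted e f p Y := by
  simp only [trace_dualMatrix_mul, Finset.sum_neg_distrib, sum_weighted_single]

/-- This is self-duality of the semidefinite cone, tested one beam and one access point at a time.
-/
theorem dualMatrix_posSemidef {e f : Fin S.NUE → ℝ} {p : ℝ}
    (h : ∀ Y ∈ psdCone S, weighted e f p Y ≤ 0) : dualMatrix e f p ∈ psdCone S := by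
  intro l j
  refine posSemidef_of_trace_mul_nonneg ?_ fun B hB => ?_
  · have hr : ∀ (r : ℝ) {A : Matrix (Fin (S.NA j)) (Fin (S.NA j)) ℂ}, A.IsHermitian →
        (r • A).IsHermitian := fun r A hA => by
      rw [Matrix.IsHermitian, Matrix.conjTranspose_smul, hA.eq, star_trivial]
    refine (hr p Matrix.isHermitian_one).sub ?_
    rw [Matrix.IsHermitian, Matrix.conjTranspose_sum]
    exact Finset.sum_congr rfl fun i _ => (hr _ (chan_posSemidef i j).isHermitian).eq
  · have h1 := trace_dualMatrix_mul e f p l (Pi.single j B)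
    rw [Finset.sum_eq_single j (fun m _ hm => by rw [Pi.single_eq_of_ne hm]; simp) (by simp),
      Pi.single_eq_same] at h1
    rw [h1, neg_nonneg]
    refine h _ (single_mem_psdCone l fun m => ?_)
    by_cases hm : m = j
    · subst hm; simpa using hB
    · simpa [Pi.single_eq_of_ne hm] using Matrix.PosSemidef.zero

/-- At `J = x.I` the slope `1 / (J i + σ i ^ 2)` of the linearization is the derivative of the true
logarithm, so both programs have the same first-order conditions. -/
theorem SubKKT.isStationary {x : Vars S} (hS : S.Admissible) (hf : x.SubFeasible x.I)
    {a b μ : Fin S.NUE → ℝ} {p : ℝ} (h : SubKKT x.I x a b μ p) (hs : ∑ i, (a i + b i) = 1) :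
    x.IsStationary := by
  have hfeas := hf.feasible hS hf.I_nonneg
  set e := energyWeight x b μ with he
  set f := interfWeight x.I μ with hfw
  have hZ := dualMatrix_posSemidef h.weighted_nonpos
  -- The multipliers of the eliminated equations are the weights of `E` and `I` and the common value
  -- `a i / α i = b i / β i`. The bounds on `α` are inactive, hence the zeros. The dual matrix
  -- absorbs the derivative in `X`.
  refine ⟨⟨a, b, e, fun i => -f i, μ, p, dualMatrix e f p, fun i => a i / x.α i, 0, 0⟩, hfeas,
    h.a_nonneg, h.b_nonneg, h.μ_nonneg, h.p_nonneg, hZ, fun _ => le_rfl, fun _ => le_rfl,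
    h.a_slack, fun i => ?_, fun i => ?_, h.p_slack, fun l j => ?_, fun i => by simp,
    fun i => by simp, fun d _ => ?_⟩
  · have := h.b_slack i
    rwa [energyUtilitySlack, hf.β_eq, ← hf.E_eq] at this
  · have := h.μ_slack i
    rwa [rateSlack, ← hf.E_eq, ← hf.I_eq, sub_self, mul_zero, add_zero] at this
  · have hn : ∀ l j, 0 ≤ (Matrix.trace (dualMatrix e f p l j * x.X l j)).re := fun l j =>
      (Complex.nonneg_iff.1 (trace_mul_nonneg (hZ l j) (hf.psd l j))).1
    have h0 := sum_trace_dualMatrix_mul e f p x.X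
    rw [h.weighted_eq, neg_zero] at h0
    have h1 := (Finset.sum_eq_zero_iff_of_nonneg fun l _ =>
      Finset.sum_nonneg fun j _ => hn l j).1 h0 l (Finset.mem_univ l)
    have h2 := (Finset.sum_eq_zero_iff_of_nonneg fun j _ => hn l j).1 h1 j (Finset.mem_univ j)
    exact mul_eq_zero_of_trace_mul_eq_zero (hZ l j) (hf.psd l j) (Complex.ext h2
      (Complex.nonneg_iff.1 (trace_mul_nonneg (hZ l j) (hf.psd l j))).2.symm)
  · set D := d.X with hD
    have hX : ∀ t, (x.move d t).X = x.X + t • D := fun t => rfl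
    have d1 : ∀ i, HasDerivAt (fun t : ℝ => Real.log ((x.move d t).α i) +
        Real.log ((x.move d t).R i) - ((x.move d t).lam + Real.log (S.v1 i)))
        (d.α i / x.α i + d.R i / x.R i - d.lam) 0 := fun i =>
      ((hasDerivAt_log_affine (hf.α_pos i).ne').add (hasDerivAt_log_affine (hf.R_pos i).ne')).sub
        ((hasDerivAt_affine _ _).add_const _)
    have d2 : ∀ i, HasDerivAt (fun t : ℝ => Real.log ((x.move d t).β i) +
        Real.log (S.η i * (x.move d t).E i) - ((x.move d t).lam + Real.log (S.v2 i)))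
        (d.β i / x.β i + d.E i / x.E i - d.lam) 0 := fun i => by
      have h3 := hasDerivAt_log_affine (b := S.η i * d.E i)
        (mul_pos (hS.η_pos i) (hf.E_pos i)).ne'
      rw [mul_div_mul_left _ _ (hS.η_pos i).ne'] at h3
      have e2 : ∀ t : ℝ, S.η i * (x.move d t).E i = S.η i * x.E i + t * (S.η i * d.E i) :=
        fun t => by
          simp only [Vars.move, Pi.add_apply, Pi.smul_apply, smul_eq_mul]; ring
      simp only [e2]
      exact ((hasDerivAt_log_affine (hf.β_pos i).ne').add h3).sub
        ((hasDerivAt_affine _ _).add_const _)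
    have d3 : ∀ i, HasDerivAt (fun t : ℝ => energy S (x.move d t).X i - (x.move d t).E i)
        (energy S D i - d.E i) 0 := fun i => by
      simp only [hX, energy_add, energy_smul]
      exact (hasDerivAt_affine _ _).sub (hasDerivAt_affine _ _)
    have d4 : ∀ i, HasDerivAt (fun t : ℝ => interference S (x.move d t).X i - (x.move d t).I i)
        (interference S D i - d.I i) 0 := fun i => by
      simp only [hX, interference_add, interference_smul]
      exact (hasDerivAt_affine _ _).sub (hasDerivAt_affine _ _)
    have d5 : ∀ i, HasDerivAt (fun t : ℝ => Real.log ((x.move d t).E i + S.σ i ^ 2) -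
        Real.log ((x.move d t).I i + S.σ i ^ 2) - (x.move d t).R i)
        (d.E i / (x.E i + S.σ i ^ 2) - d.I i / (x.I i + S.σ i ^ 2) - d.R i) 0 := fun i => by
      have e1 : ∀ t : ℝ, (x.move d t).E i + S.σ i ^ 2 = x.E i + S.σ i ^ 2 + t * d.E i :=
        fun t => by simp only [Vars.move, Pi.add_apply, Pi.smul_apply, smul_eq_mul]; ring
      have e2 : ∀ t : ℝ, (x.move d t).I i + S.σ i ^ 2 = x.I i + S.σ i ^ 2 + t * d.I i :=
        fun t => by simp only [Vars.move, Pi.add_apply, Pi.smul_apply, smul_eq_mul]; ring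
      simp only [e1, e2]
      exact ((hasDerivAt_log_affine (hS.add_sq_pos (hf.E_nonneg i) i).ne').sub
        (hasDerivAt_log_affine (hS.add_sq_pos (hf.I_nonneg i) i).ne')).sub (hasDerivAt_affine _ _)
    have d6 : HasDerivAt (fun t : ℝ => S.Pmax - power S (x.move d t).X) (-power S D) 0 := by
      simp only [hX, power_add, power_smul]
      exact (hasDerivAt_affine _ _).const_sub _
    have d7 : HasDerivAt (fun t : ℝ => ∑ l, ∑ j,
        (Matrix.trace (dualMatrix e f p l j * (x.move d t).X l j)).re) (-weighted e f p D) 0 := by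
      simp only [hX, sum_trace_dualMatrix_mul, weighted_add, weighted_smul]
      exact (hasDerivAt_affine _ _).neg
    have d8 : ∀ i, HasDerivAt (fun t : ℝ => 1 - (x.move d t).α i - (x.move d t).β i)
        (-d.α i - d.β i) 0 := fun i =>
      ((hasDerivAt_affine _ _).const_sub _).sub (hasDerivAt_affine _ _)
    have d0 : HasDerivAt (fun t : ℝ => (x.move d t).lam) d.lam 0 := hasDerivAt_affine _ _
    have hsum := (((((((d0.add
      (HasDerivAt.fun_sum (u := Finset.univ) fun i _ => (d1 i).const_mul (a i))).add
      (HasDerivAt.fun_sum (u := Finset.univ) fun i _ => (d2 i).const_mul (b i))).add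
      (HasDerivAt.fun_sum (u := Finset.univ) fun i _ => (d3 i).const_mul (e i))).add
      (HasDerivAt.fun_sum (u := Finset.univ) fun i _ => (d4 i).const_mul (-f i))).add
      (HasDerivAt.fun_sum (u := Finset.univ) fun i _ => (d5 i).const_mul (μ i))).add
      (d6.const_mul p)).add d7).add
      (HasDerivAt.fun_sum (u := Finset.univ) fun i _ => (d8 i).const_mul (a i / x.α i))
    simp only [lagrangian, Pi.zero_apply, zero_mul, Finset.sum_const_zero, add_zero]
    refine hsum.congr_deriv ?_
    -- After cancellation the coefficient of `d.lam` is `1 - ∑ i, (a i + b i)`, which the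
    -- normalization makes zero.
    have hterm : ∀ i, a i * (d.α i / x.α i + d.R i / x.R i - d.lam) +
        b i * (d.β i / x.β i + d.E i / x.E i - d.lam) + e i * (energy S D i - d.E i) +
        -f i * (interference S D i - d.I i) +
        μ i * (d.E i / (x.E i + S.σ i ^ 2) - d.I i / (x.I i + S.σ i ^ 2) - d.R i) +
        a i / x.α i * (-d.α i - d.β i) =
        (e i * energy S D i - f i * interference S D i) - d.lam * (a i + b i) := fun i => by
      have h1 := h.ratio i
      have h2 := h.rate i
      have h3 : a i * (d.R i / x.R i) = μ i * d.R i := by rw [← h2]; ring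
      have h4 : b i * (d.β i / x.β i) = a i / x.α i * d.β i := by rw [h1]; ring
      rw [he, hfw, energyWeight, interfWeight]
      linear_combination h3 + h4
    have htot := Finset.sum_congr rfl fun i (_ : i ∈ (Finset.univ : Finset (Fin S.NUE))) => hterm i
    simp only [Finset.sum_add_distrib, Finset.sum_sub_distrib, ← Finset.mul_sum] at htot
    rw [Finset.sum_add_distrib] at hs
    rw [hs] at htot
    rw [weighted, Finset.sum_sub_distrib]
    linarith

/-! ### Optimal solutions leave no rate constraint slack -/

/-- At an optimal solution of the subproblem, no user has a slack rate constraint, provided the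
users with `J i ≠ I i` all have one. -/
theorem Vars.SubOptimal.rateSlack_nonpos (hS : S.Admissible) {J : Fin S.NUE → ℝ}
    (hJ : ∀ i, 0 ≤ J i) {x : Vars S} (hx : x.SubOptimal J)
    (hsl : ∀ i, J i ≠ x.I i → 0 < rateSlack J x.X x.R i) (i : Fin S.NUE) :
    rateSlack J x.X x.R i ≤ 0 := by
  obtain ⟨a, b, μ, p, h, hs⟩ := hx.exists_subKKT hS
  by_contra! hi
  have hf := hx.1
  have hfeas := hf.feasible hS hJ
  set e := energyWeight x b μ with he
  set f := interfWeight J μ with hfw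
  -- A slack rate gives `μ m = 0`. Stationarity in `R` then gives `a m = 0`, and stationarity in `α`
  -- gives `b m = 0`, so such a user carries no weight at all.
  have hμ0 : ∀ m, 0 < rateSlack J x.X x.R m → μ m = 0 := fun m hm =>
    (mul_eq_zero.1 (h.μ_slack m)).resolve_right hm.ne'
  have ha0 : ∀ m, μ m = 0 → a m = 0 := fun m hm => by
    have := h.rate m
    rw [hm, div_eq_zero_iff] at this
    exact this.resolve_right (hf.R_pos m).ne'
  have hb0 : ∀ m, μ m = 0 → b m = 0 := fun m hm => by
    have := h.ratio m
    rw [ha0 m hm, zero_div, eq_comm, div_eq_zero_iff] at this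
    exact this.resolve_right (hf.β_pos m).ne'
  have he0 : ∀ m, μ m = 0 → e m = 0 := fun m hm => by
    rw [he, energyWeight, hm, hb0 m hm]; simp
  have hf0 : ∀ m, μ m = 0 → f m = 0 := fun m hm => by rw [hfw, interfWeight, hm]; simp
  set Bi : Precoders S := Pi.single i (x.X i) with hBi
  have hBip : Bi ∈ psdCone S := single_mem_psdCone i (hf.psd i)
  -- transferring the beam of user `i` to user `l` is not profitable
  have hcross : ∀ l, μ l ≠ 0 → received l (x.X i) = 0 := fun l hl => by
    have hli : l ≠ i := fun hli => hl (hli ▸ hμ0 i hi)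
    set Bl : Precoders S := Pi.single l (x.X i) with hBl
    have hmem : x.X + (-1 : ℝ) • Bi + Bl ∈ psdCone S := by
      refine fun m => ?_
      by_cases hmi : m = i
      · subst hmi
        have : (x.X + (-1 : ℝ) • Bi + Bl) m = 0 := by
          simp [hBi, hBl, Pi.single_eq_of_ne (Ne.symm hli)]
        intro j
        rw [this]
        exact Matrix.PosSemidef.zero
      · have : (x.X + (-1 : ℝ) • Bi + Bl) m = x.X m + Bl m := by
          simp [hBi, Pi.single_eq_of_ne hmi]
        intro j
        rw [this]
        exact (hf.psd m j).add (single_mem_psdCone l (hf.psd i) m j)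
    have h1 := h.weighted_nonpos _ hmem
    rw [weighted_add, weighted_add, weighted_smul, h.weighted_eq] at h1
    have h2 : weighted e f p Bl - weighted e f p Bi =
        f l * received l (x.X i) - f i * received i (x.X i) := by
      have h3 : ∀ k, weighted e f p (Pi.single k (x.X i)) =
          ∑ m, (e m * received m (x.X i)) - ∑ m, f m * received m (x.X i) +
          f k * received k (x.X i) - p * ∑ j, (x.X i j).trace.re := fun k => by
        simp only [weighted, energy_single, interference_single, power_single]
        have h4 : ∀ m, f m * (if m = k then 0 else received m (x.X i)) =
            f m * received m (x.X i) - if m = k then f k * received k (x.X i) else 0 := fun m => by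
          split_ifs with hm
          · rw [hm]; ring
          · ring
        simp only [h4, Finset.sum_sub_distrib, Finset.sum_ite_eq', Finset.mem_univ, if_true]
        ring
      rw [h3, h3]; ring
    rw [hf0 i (hμ0 i hi)] at h2
    have hfl : 0 < f l := div_pos ((h.μ_nonneg l).lt_of_ne hl.symm) (hS.add_sq_pos (hJ l) l)
    have hn := received_nonneg l (hf.psd i)
    have : f l * received l (x.X i) ≤ 0 := by linarith
    exact le_antisymm (nonpos_of_mul_nonpos_right this hfl) hn
  -- hence the power constraint has multiplier zero
  have hWi : weighted e f p Bi = 0 := by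
    refine le_antisymm (h.weighted_nonpos _ hBip) ?_
    have hmem : x.X + (-1 : ℝ) • Bi ∈ psdCone S := by
      refine fun m => ?_
      by_cases hmi : m = i
      · subst hmi
        have : (x.X + (-1 : ℝ) • Bi) m = 0 := by simp [hBi]
        intro j
        rw [this]
        exact Matrix.PosSemidef.zero
      · have : (x.X + (-1 : ℝ) • Bi) m = x.X m := by simp [hBi, Pi.single_eq_of_ne hmi]
        intro j
        rw [this]
        exact hf.psd m j
    have h1 := h.weighted_nonpos _ hmem
    rw [weighted_add, weighted_smul, h.weighted_eq] at h1
    linarith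
  -- No weighted user hears the beam of user `i`, so its value is minus its power cost. That beam
  -- has nonzero power because a positive rate forces `I i < E i`.
  have hp : p = 0 := by
    have h1 : weighted e f p Bi = -(p * power S Bi) := by
      rw [weighted, Finset.sum_eq_zero, zero_sub]
      intro m _
      rw [hBi, energy_single, interference_single]
      by_cases hm : μ m = 0
      · rw [he0 m hm, hf0 m hm]; simp
      · rw [hcross m hm]; simp
    rw [hWi, eq_comm, neg_eq_zero] at h1
    refine (mul_eq_zero.1 h1).resolve_right fun h0 => ?_
    have h2 := received_eq_zero_of_power_eq_zero hBip h0 i i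
    rw [hBi, Pi.single_eq_same] at h2
    have h3 := hfeas.I_lt_E hS i
    rw [hf.I_eq, hf.E_eq, energy_eq_interference_add, h2] at h3
    linarith
  have hterm : ∀ m, e m * energy S x.X m - f m * interference S x.X m =
      b m + μ m * (x.E m / (x.E m + S.σ m ^ 2) - x.I m / (J m + S.σ m ^ 2)) := fun m => by
    rw [← hf.E_eq, ← hf.I_eq, he, hfw, energyWeight, interfWeight]
    have := (hf.E_pos m).ne'
    field_simp
    ring
  -- This is the relative gain from amplifying all beams: since the noise stays fixed, signal plus
  -- interference gains more than interference alone. It needs `J m = I m`, which `hsl` supplies for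
  -- every user with `μ m ≠ 0`.
  have hgain : ∀ m, μ m ≠ 0 →
      0 < x.E m / (x.E m + S.σ m ^ 2) - x.I m / (J m + S.σ m ^ 2) := fun m hm => by
    have hJm : J m = x.I m := by
      by_contra hne
      exact hm (hμ0 m (hsl m hne))
    have hlt := hfeas.I_lt_E hS m
    have hσ := hS.σ_pos m
    rw [hJm, sub_pos, div_lt_div_iff₀ (hS.add_sq_pos (hf.I_nonneg m) m)
      (hS.add_sq_pos (hf.E_nonneg m) m)]
    nlinarith [mul_lt_mul_of_pos_right hlt (pow_pos hσ 2)]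
  have hnn : ∀ m, 0 ≤ μ m * (x.E m / (x.E m + S.σ m ^ 2) - x.I m / (J m + S.σ m ^ 2)) :=
    fun m => by
      by_cases hm : μ m = 0
      · rw [hm, zero_mul]
      · exact mul_nonneg (h.μ_nonneg m) (hgain m hm).le
  have hW := h.weighted_eq
  rw [weighted, hp, zero_mul, sub_zero, Finset.sum_congr rfl fun m _ => hterm m,
    Finset.sum_eq_zero_iff_of_nonneg fun m _ => add_nonneg (h.b_nonneg m) (hnn m)] at hW
  have hμ : ∀ m, μ m = 0 := fun m => by
    by_contra hm
    have h1 := hW m (Finset.mem_univ m)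
    have h2 := mul_pos ((h.μ_nonneg m).lt_of_ne (Ne.symm hm)) (hgain m hm)
    linarith [h.b_nonneg m]
  rw [Finset.sum_eq_zero fun m _ => by rw [ha0 m (hμ m), hb0 m (hμ m), add_zero]] at hs
  exact zero_ne_one hs

theorem Vars.SubOptimal.isStationary (hS : S.Admissible) {x : Vars S} (hx : x.SubOptimal x.I) :
    x.IsStationary :=
  let ⟨_, _, _, _, h, hs⟩ := hx.exists_subKKT hS
  h.isStationary hS hx.1 hs

/-! ### Monotonicity and limits of the iteration -/

theorem step_apply (γ : ℝ) (J : Fin S.NUE → ℝ) (x : Vars S) (i : Fin S.NUE) :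
    step γ J x i + S.σ i ^ 2 =
      J i + S.σ i ^ 2 + γ * (x.I i + S.σ i ^ 2 - (J i + S.σ i ^ 2)) := by
  simp only [step, Pi.add_apply, Pi.smul_apply, Pi.sub_apply, smul_eq_mul]; ring

/-- The rate slack does not decrease when the linearization point is moved towards the
interference. -/
theorem rateSlack_step (hS : S.Admissible) {γ : ℝ} (h0 : 0 < γ) (h1 : γ ≤ 1)
    {J : Fin S.NUE → ℝ} (hJ : ∀ i, 0 ≤ J i) {x : Vars S} (hx : x.SubFeasible J) (i : Fin S.NUE) :
    rateSlack J x.X x.R i ≤ rateSlack (step γ J x) x.X x.R i ∧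
      (J i ≠ x.I i → rateSlack J x.X x.R i < rateSlack (step γ J x) x.X x.R i) := by
  have e : ∀ K : Fin S.NUE → ℝ, rateSlack K x.X x.R i = Real.log (x.E i + S.σ i ^ 2) -
      (Real.log (K i + S.σ i ^ 2) +
        1 / (K i + S.σ i ^ 2) * (x.I i + S.σ i ^ 2 - (K i + S.σ i ^ 2))) - x.R i := fun K => by
    rw [rateSlack, ← hx.E_eq, ← hx.I_eq, add_sub_add_right_eq_sub]
  have hI := hS.add_sq_pos (hx.I_nonneg i) i
  have hJi := hS.add_sq_pos (hJ i) i
  rw [e, e, step_apply]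
  refine ⟨?_, fun hne => ?_⟩
  · linarith [tangent_le_tangent hI hJi h0 h1]
  · linarith [tangent_lt_tangent hI hJi (fun h => hne (by linarith)) h0 h1]

/-- The old solution competes in the next subproblem even for a damped step, so the levels never
decrease. -/
theorem Vars.SubFeasible.subFeasible_step (hS : S.Admissible) {γ : ℝ} (h0 : 0 < γ) (h1 : γ ≤ 1)
    {J : Fin S.NUE → ℝ} (hJ : ∀ i, 0 ≤ J i) {x : Vars S} (hx : x.SubFeasible J) :
    x.SubFeasible (step γ J x) := by
  refine ⟨hx.toCommon, fun i => ?_⟩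
  have := (hx.rateSlack_nonneg i).trans (rateSlack_step hS h0 h1 hJ hx i).1
  rw [rateSlack, ← hx.E_eq, ← hx.I_eq] at this
  linarith

theorem gap_eq_zero {J : Fin S.NUE → ℝ} {x : Vars S} (h : gap J x = 0) : J = x.I := by
  rw [gap, norm_eq_zero, WithLp.toLp_eq_zero, sub_eq_zero] at h
  exact h.symm

section Run

variable {γ : ℝ} {J : ℕ → Fin S.NUE → ℝ} {x : ℕ → Vars S}

theorem IsRun.mem_startSet (hS : S.Admissible) (h0 : 0 < γ) (h1 : γ ≤ 1) (h : IsRun γ J x)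
    (k : ℕ) : J k ∈ startSet S := by
  induction k with
  | zero => exact h.start
  | succ k ih =>
    rw [h.update]
    exact step_mem_startSet hS.η_pos h0 h1 ih (h.solve k).1.toLinear

theorem IsRun.monotone (hS : S.Admissible) (h0 : 0 < γ) (h1 : γ ≤ 1) (h : IsRun γ J x) :
    Monotone fun k => (x k).lam :=
  monotone_nat_of_le_succ fun k => (h.solve (k + 1)).2 _ <| by
    rw [h.update]
    exact (h.solve k).1.subFeasible_step hS h0 h1
      (nonneg_of_mem_startSet (h.mem_startSet hS h0 h1 k))

theorem IsRun.exists_tendsto (hS : S.Admissible) (h0 : 0 < γ) (h1 : γ ≤ 1) (h : IsRun γ J x) :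
    ∃ L, Tendsto (fun k => (x k).lam) atTop (𝓝 L) := by
  obtain ⟨M, L, hML⟩ := exists_bound hS
  exact ⟨_, tendsto_atTop_ciSup (h.monotone hS h0 h1) ⟨L, by
    rintro _ ⟨k, rfl⟩
    exact (hML _ ((h.solve k).1.feasible hS
      (nonneg_of_mem_startSet (h.mem_startSet hS h0 h1 k)))).2⟩⟩

/-- Subsequential convergence to stationary points. -/
theorem IsRun.exists_subseq (hS : S.Admissible) (h0 : 0 < γ) (h1 : γ ≤ 1) (h : IsRun γ J x)
    {L : ℝ} (hL : Tendsto (fun k => (x k).lam) atTop (𝓝 L)) {φ : ℕ → ℕ}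
    (hφ : Tendsto φ atTop atTop) :
    ∃ ψ : ℕ → ℕ, StrictMono ψ ∧ ∃ x' : Vars S, x'.IsStationary ∧ x'.lam = L ∧
      Vars.ConvergesTo (fun k => x (φ (ψ k))) x' ∧
      Tendsto (fun k => J (φ (ψ k))) atTop (𝓝 x'.I) := by
  have hmono := h.monotone hS h0 h1
  obtain ⟨ψ, hψ, J', hJm, x', hJ', hx', hf⟩ := exists_subseq_convergesTo hS
    (J := fun k => J (φ k)) (x := fun k => x (φ k)) (c := (x 0).lam)
    (fun k => h.mem_startSet hS h0 h1 _) (fun k => (h.solve _).1) fun k => hmono (Nat.zero_le _)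
  have hJ0 := nonneg_of_mem_startSet hJm
  have hφψ : Tendsto (fun k => φ (ψ k)) atTop atTop := hφ.comp hψ.tendsto_atTop
  have hlam : x'.lam = L := tendsto_nhds_unique hx'.lam (hL.comp hφψ)
  have hnext : Tendsto (fun k => J (φ (ψ k) + 1)) atTop (𝓝 (step γ J' x')) := by
    simp only [h.update, step]
    exact hJ'.add ((hx'.I.sub hJ').const_smul γ)
  have hstep0 := nonneg_of_mem_startSet (step_mem_startSet hS.η_pos h0 h1 hJm hf.toLinear)
  -- A better `y` at the limiting next base point would give, by lower semicontinuity, competitors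
  -- at late iterates with level above `L`, while all levels of the run are at most `L`.
  have hopt : x'.SubOptimal (step γ J' x') := by
    refine ⟨hf.subFeasible_step hS h0 h1 hJ0, fun y hy => ?_⟩
    by_contra! hlt
    obtain ⟨k, z, hz, hzl⟩ := (hy.eventually_exists hS hstep0 hlt hnext).exists
    have h2 := (h.solve _).2 z hz
    have h3 := hmono.ge_of_tendsto hL (φ (ψ k) + 1)
    linarith
  have hJI : ∀ i, J' i = x'.I i → step γ J' x' i = x'.I i := fun i hi => by
    simp [step, hi]
  have hslack : ∀ i, J' i ≠ x'.I i → 0 < rateSlack (step γ J' x') x'.X x'.R i := fun i hi =>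
    (hf.rateSlack_nonneg i).trans_lt ((rateSlack_step hS h0 h1 hJ0 hf i).2 hi)
  -- A user with `J' i ≠ x'.I i` gains strict slack in the step. The stepped point can differ from
  -- `x'.I` only at such users, so the slackness hypothesis of `rateSlack_nonpos` holds.
  have hJx : J' = x'.I := by
    funext i
    by_contra hne
    exact absurd (hslack i hne) (hopt.rateSlack_nonpos hS hstep0
      (fun m hm => hslack m fun h => hm (hJI m h)) i).not_gt
  have hstep : step γ J' x' = x'.I := funext fun i => hJI i (congrFun hJx i)
  rw [hstep] at hopt
  exact ⟨ψ, hψ, x', hopt.isStationary hS, hlam, hx', hJx ▸ hJ'⟩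

theorem tendsto_gap_of_convergesTo {u : ℕ → Fin S.NUE → ℝ} {y : ℕ → Vars S} {x' : Vars S}
    (hy : Vars.ConvergesTo y x') (hu : Tendsto u atTop (𝓝 x'.I)) :
    Tendsto (fun k => gap (u k) (y k)) atTop (𝓝 0) := by
  have h1 : Tendsto (fun k => (y k).I - u k) atTop (𝓝 0) := by simpa using hy.I.sub hu
  have h2 := (((PiLp.continuous_toLp 2 fun _ : Fin S.NUE => ℝ).norm).tendsto 0).comp h1
  rwa [WithLp.toLp_zero, norm_zero] at h2

theorem IsRun.tendsto_gap (hS : S.Admissible) (h0 : 0 < γ) (h1 : γ ≤ 1) (h : IsRun γ J x) :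
    Tendsto (fun k => gap (J k) (x k)) atTop (𝓝 0) := by
  obtain ⟨L, hL⟩ := h.exists_tendsto hS h0 h1
  refine tendsto_of_subseq_tendsto fun φ hφ => ?_
  obtain ⟨ψ, -, x', -, -, hx', hJ'⟩ := h.exists_subseq hS h0 h1 hL hφ
  exact ⟨ψ, tendsto_gap_of_convergesTo hx' hJ'⟩

theorem IsRun.isConnected (hS : S.Admissible) (h0 : 0 < γ) (h1 : γ ≤ 1) (h : IsRun γ J x) :
    IsConnected {K : Fin S.NUE → ℝ | MapClusterPt K atTop J} := by
  refine isConnected_setOf_mapClusterPt (isCompact_startSet hS.η_pos)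
    (h.mem_startSet hS h0 h1) ?_
  -- Distances in `Fin S.NUE → ℝ` use the maximum norm, which the Euclidean norm in `gap` dominates.
  have hle : ∀ k, dist (J (k + 1)) (J k) ≤ γ * gap (J k) (x k) := fun k => by
    rw [h.update, step, dist_eq_norm, add_sub_cancel_left, norm_smul, Real.norm_of_nonneg h0.le]
    refine mul_le_mul_of_nonneg_left ?_ h0.le
    refine (pi_norm_le_iff_of_nonneg (norm_nonneg _)).2 fun i => ?_
    exact PiLp.norm_apply_le (WithLp.toLp 2 ((x k).I - J k)) i
  exact squeeze_zero (fun _ => dist_nonneg) hle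
    (by simpa using (h.tendsto_gap hS h0 h1).const_mul γ)

end Run

end SWIPT

theorem proposition2 (S : SWIPT.Network) (hUE : 0 < S.NUE)
    (hh : ∀ i, ∃ j, S.h i j ≠ 0) (hσ : ∀ i, 0 < S.σ i) (hη : ∀ i, 0 < S.η i)
    (hv1 : ∀ i, 0 < S.v1 i) (hv2 : ∀ i, 0 < S.v2 i) (hP : 0 < S.Pmax)
    (γ : ℝ) (hγ0 : 0 < γ) (hγ1 : γ ≤ 1) :
    -- the algorithm can start, and it never gets stuck
    (SWIPT.startSet S).Nonempty ∧
    (∀ J ∈ SWIPT.startSet S, (∃ x : SWIPT.Vars S, x.SubOptimal J) ∧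
      ∀ x : SWIPT.Vars S, x.SubOptimal J → SWIPT.step γ J x ∈ SWIPT.startSet S) ∧
    ∀ (J : ℕ → Fin S.NUE → ℝ) (x : ℕ → SWIPT.Vars S), SWIPT.IsRun γ J x →
      -- the stopping test is met for every positive tolerance, and with gap zero it is exact
      Tendsto (fun k => SWIPT.gap (J k) (x k)) atTop (𝓝 0) ∧
      (∀ ε : ℝ, 0 < ε → ∃ k, SWIPT.gap (J k) (x k) ≤ ε) ∧
      (∀ k, SWIPT.gap (J k) (x k) = 0 → (x k).IsStationary) ∧
      -- the objective converges, and the iterates converge to the stationary points of that value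
      (∃ lamStar : ℝ, Tendsto (fun k => (x k).lam) atTop (𝓝 lamStar) ∧
        ∀ φ : ℕ → ℕ, StrictMono φ → ∃ ψ : ℕ → ℕ, StrictMono ψ ∧
          ∃ xStar : SWIPT.Vars S, xStar.IsStationary ∧ xStar.lam = lamStar ∧
            SWIPT.Vars.ConvergesTo (fun k => x (φ (ψ k))) xStar ∧
            Tendsto (fun k => J (φ (ψ k))) atTop (𝓝 xStar.I)) ∧
      -- the limit points form a connected set
      IsConnected {K : Fin S.NUE → ℝ | MapClusterPt K atTop J} := by
  have hS : S.Admissible := ⟨hUE, hh, hσ, hη, hv1, hv2, hP⟩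
  refine ⟨?_, fun J hJ => ⟨SWIPT.exists_subOptimal hS hJ, fun x hx =>
    SWIPT.step_mem_startSet hη hγ0 hγ1 hJ hx.1.toLinear⟩, fun J x h => ?_⟩
  · rw [SWIPT.startSet_eq_image hη]
    exact ⟨_, 0, SWIPT.zero_mem_budgetSet hP, rfl⟩
  · have hgap := h.tendsto_gap hS hγ0 hγ1
    obtain ⟨L, hL⟩ := h.exists_tendsto hS hγ0 hγ1
    refine ⟨hgap, fun ε hε => (hgap.eventually (ge_mem_nhds hε)).exists, fun k hk => ?_,
      ⟨L, hL, fun φ hφ => h.exists_subseq hS hγ0 hγ1 hL hφ.tendsto_atTop⟩,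
      h.isConnected hS hγ0 hγ1⟩
    have hx := h.solve k
    rw [SWIPT.gap_eq_zero hk] at hx
    exact hx.isStationary hS
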